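/- Fix constants $\tau\in(0,1)$, $a_1>0$, $0<a_2<a$, $u_0>0$, $0<f_{\min}\le f_{\max}<\infty$, and put $a_0=\min\{1,a_2\}$. There is a constant $C_1>0$, depending only on these constants, such that the following holds. For every $\lambda>0$ let $P_\lambda$ be a folded concave penalty: on $[0,\infty)$ it is nondecreasing and concave with $P_\lambda(0)=0$; it is differentiable on $(0,\infty)$ and $P'_\lambda(0):=P'_\lambda(0+)$ exists and is $\ge a_1\lambda$; $P'_\lambda(t)\ge a_1\lambda$ for $t\in(0,a_2\lambda]$; and $P'_\lambda(t)=0$ for $t\ge a\lambda$, $t>0$. Consider a sequence of linear models $\mathbf y=\mathbf X\beta^\star+\varepsilon$ whose sample size $n$ tends to infinity. Here $\mathbf X\in\mathbb R^{n\times p}$ is a fixed design with rows $\mathbf x_i'$, and $\varepsilon_1,\dots,\varepsilon_n$ are independent with densities $f_i$ and $\Pr(\varepsilon_i\le 0)=\tau$. The quantities $p$, $\mathbf X$, $\beta^\star$, the law of $\varepsilon$ and the tuning parameter $\lambda>0$ may vary along the sequence. Let $\mathcal A=\{j:\beta_j^\star\ne0\}\neq\emptyset$, $s=|\mathcal A|$,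 $\|\beta^\star_{\mathcal A}\|_{\min}=\min_{j\in\mathcal A}|\beta^\star_j|$, $M_{\mathcal A}=\max_i\frac1s\|\mathbf x_{i\mathcal A}\|_{\ell_2}^2$, $m_{\mathcal A^c}=\max_{i,\,j\in\mathcal A^c}|x_{ij}|$ (zero if $\mathcal A^c=\emptyset$), and let $\lambda_{\min}$ be the smallest eigenvalue of $\frac1n\mathbf X_{\mathcal A}'\mathbf X_{\mathcal A}$. Let $\ell_n(\beta)=\frac1n\sum_i\rho_\tau(y_i-\mathbf x_i'\beta)$ with $\rho_\tau(u)=u(\tau-I_{\{u\le0\}})$, and let $\hat\beta^{\mathrm{oracle}}$ be the minimizer of $\ell_n$ over $\{\beta:\beta_{\mathcal A^c}=0\}$, which is assumed to exist and be unique almost surely. Let $\hat\beta^{\mathrm{initial}}$ be any initial estimator. The LLA algorithm starts at $\hat\beta^{(0)}=\hat\beta^{\mathrm{initial}}$ and takes, for $m\ge1$, $\hat\beta^{(m)}\in\arg\min_\beta\ \ell_n(\beta)+\sum_jP'_\lambda(|\hat\beta_j^{(m-1)}|)\,|\beta_j|$. Suppose that, along the sequence, 1. (C3) $f_{\min}\le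 \min_i f_i(u)\le\max_i f_i(u)\le f_{\max}$ for all $|u|\le u_0$; 2. (A0) $\|\beta^\star_{\mathcal A}\|_{\min}>(a+1)\lambda$; 3. $\lambda\gg 1/n$ and $\log p=o(n\lambda^2)$; 4. $(M_{\mathcal A}s)^{1/2}(\|\beta^\star_{\mathcal A}\|_{\min}-a\lambda)\le u_0$; 5. $m_{\mathcal A^c}M_{\mathcal A}s=o\bigl(n^{1/2}\lambda/\log^{1/2}n\bigr)$; 6. $M_{\mathcal A}$ is bounded away from zero. Then for all sufficiently large indices of the sequence, with probability at least $1-\delta_0-\delta_1^Q-\delta_2^Q$ the LLA algorithm initialized by $\hat\beta^{\mathrm{initial}}$ converges to $\hat\beta^{\mathrm{oracle}}$ after two iterations (that is, $\hat\beta^{(1)}=\hat\beta^{(2)}=\hat\beta^{\mathrm{oracle}}$, and all later iterates equal it too), where $\delta_0=\Pr(\|\hat\beta^{\mathrm{initial}}-\beta^\star\|_{\max}>a_0\lambda)$, $$\delta_1^Q=4n^{-1/2}+C_1(p-s)\exp\Bigl(-\frac{a_1n\lambda}{104\,m_{\mathcal A^c}}\Bigr)+2(p-s)\exp\Bigl(-\frac{a_1^2n\lambda^2}{32\,m_{\mathcal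 A^c}^2}\Bigr),$$ $$\delta_2^Q=4\exp\Bigl(-\frac{\lambda_{\min}^2f_{\min}^2}{72M_{\mathcal A}}\cdot\frac ns\bigl(\|\beta^\star_{\mathcal A}\|_{\min}-a\lambda\bigr)^2\Bigr).$$ (If $m_{\mathcal A^c}=0$, the two exponentials in $\delta_1^Q$ are read as $0$.) -/

import Mathlib

open MeasureTheory ProbabilityTheory Filter Topology Asymptotics

noncomputable section

/-! ### Folded concave penalties and the local linear approximation (LLA) algorithm -/

/-- The derivative `P'(t)` of a penalty on `[0, ∞)`, with the convention `P'(0) := P'(0+)`. -/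
def penaltySlope (P : ℝ → ℝ) (t : ℝ) : ℝ :=
  if t = 0 then limUnder (𝓝[>] (0 : ℝ)) (deriv P) else deriv P t

/-- `P = P_λ` is a general folded concave penalty (as a function of `t ≥ 0`) at level `lam`, with
constants `a₁`, `a₂`, `a`. -/
structure IsFoldedConcave (a₁ a₂ a lam : ℝ) (P : ℝ → ℝ) : Prop where
  monotone : MonotoneOn P (Set.Ici 0)
  concave : ConcaveOn ℝ (Set.Ici 0) P
  zero : P 0 = 0
  differentiable : ∀ t, 0 < t → DifferentiableAt ℝ P t
  slope_zero : ∃ L, a₁ * lam ≤ L ∧ Tendsto (deriv P) (𝓝[>] (0 : ℝ)) (𝓝 L)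
  slope_near : ∀ t, 0 < t → t ≤ a₂ * lam → a₁ * lam ≤ deriv P t
  slope_far : ∀ t, 0 < t → a * lam ≤ t → deriv P t = 0

/-- `b 0, b 1, b 2, …` is a sequence of iterates of the LLA algorithm for the loss `ell` and the
penalty `P`, started at `b₀`: each `b (m + 1)` is a global minimizer of the weighted `ℓ₁` penalized
loss whose weights are `P'(|b m j|)`. -/
def IsLLARun {p : ℕ} (P : ℝ → ℝ) (ell : (Fin p → ℝ) → ℝ) (b₀ : Fin p → ℝ)
    (b : ℕ → Fin p → ℝ) : Prop :=
  b 0 = b₀ ∧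
    ∀ m, IsMinOn (fun β => ell β + ∑ j, penaltySlope P |b m j| * |β j|) Set.univ (b (m + 1))

/-- The LLA algorithm started at `b₀` converges to `target` after two iterations: whatever
minimizers are chosen, the first iterate is `target`, the second iterate is `target` again, and the
algorithm stays there. (A sequence of iterates is required to exist.) -/
def LLAConvergesInTwo {p : ℕ} (P : ℝ → ℝ) (ell : (Fin p → ℝ) → ℝ) (b₀ target : Fin p → ℝ) : Prop :=
  (∃ b, IsLLARun P ell b₀ b) ∧ ∀ b, IsLLARun P ell b₀ b → ∀ m, 1 ≤ m → b m = target

/-! ### The linear quantile regression model -/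

/-- The check loss. -/
def checkLoss (τ u : ℝ) : ℝ := u * (τ - if u ≤ 0 then 1 else 0)

/-- The linear model `y = X β* + ε` with a fixed `n × p` design and independent errors, where `ε i`
has density `f i` and `Pr (ε i ≤ 0) = τ`. -/
structure QuantileModel (τ : ℝ) where
  /-- sample size -/
  n : ℕ
  /-- dimension -/
  p : ℕ
  /-- design matrix -/
  X : Matrix (Fin n) (Fin p) ℝ
  /-- true parameter -/
  βstar : Fin p → ℝ
  /-- sample space -/
  Ω : Type*
  /-- its events -/
  mΩ : MeasurableSpace Ω
  /-- the probability -/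
  Pr : Measure Ω
  isProb : IsProbabilityMeasure Pr
  /-- errors -/
  ε : Fin n → Ω → ℝ
  /-- error densities -/
  f : Fin n → ℝ → ℝ
  measurable_ε : ∀ i, Measurable (ε i)
  indep : iIndepFun ε Pr
  quantile : ∀ i, Pr.real {ω | ε i ω ≤ 0} = τ
  measurable_f : ∀ i, Measurable (f i)
  f_nonneg : ∀ i u, 0 ≤ f i u
  density : ∀ i, Pr.map (ε i) = volume.withDensity (fun u => ENNReal.ofReal (f i u))

attribute [instance] QuantileModel.mΩ QuantileModel.isProb

namespace QuantileModel

variable {τ : ℝ} (Q : QuantileModel τ)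

/-- The responses. -/
def y (ω : Q.Ω) (i : Fin Q.n) : ℝ := (∑ j, Q.X i j * Q.βstar j) + Q.ε i ω

/-- The empirical check loss `ℓ_n(β) = (1/n) ∑ᵢ ρ_τ(yᵢ - xᵢ'β)`. -/
def loss (ω : Q.Ω) (β : Fin Q.p → ℝ) : ℝ :=
  (1 / (Q.n : ℝ)) * ∑ i, checkLoss τ (Q.y ω i - ∑ j, Q.X i j * β j)

open Classical in
/-- The true support. -/
def A : Finset (Fin Q.p) := Finset.univ.filter (fun j => Q.βstar j ≠ 0)

/-- The size of the true support. -/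
def s : ℕ := Q.A.card

/-- `‖β*_A‖_min`, the minimal signal strength. -/
def minSignal : ℝ := ⨅ j : Q.A, |Q.βstar j|

/-- `M_A = max_i (1/s) ‖x_{iA}‖₂²`. -/
def MA : ℝ := ⨆ i : Fin Q.n, (1 / (Q.s : ℝ)) * ∑ j ∈ Q.A, Q.X i j ^ 2

/-- `m_{A^c}`, the maximum of `|x_{ij}|` over all `i` and all `j ∉ A` (zero if `A` is everything). -/
def mAc : ℝ := ⨆ ij : Fin Q.n × {j : Fin Q.p // j ∉ Q.A}, |Q.X ij.1 ij.2|

/-- `X_A`, the columns of the design matrix in the true support. -/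
def XA : Matrix (Fin Q.n) Q.A ℝ := Q.X.submatrix id Subtype.val

/-- The Gram matrix `(1/n) X_A' X_A`. -/
def gram : Matrix Q.A Q.A ℝ := (1 / (Q.n : ℝ)) • (Q.XA.transpose * Q.XA)

theorem gram_isHermitian : Q.gram.IsHermitian := by
  unfold gram Matrix.IsHermitian
  simp [Matrix.conjTranspose_eq_transpose_of_trivial]

/-- `λ_min`, the smallest eigenvalue of `(1/n) X_A' X_A`. -/
def lamMin : ℝ := ⨅ j, Q.gram_isHermitian.eigenvalues j

/-- `b` is an oracle estimator at the outcome `ω`: it minimizes the loss over all vectors that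
vanish outside the true support. -/
def IsOracle (ω : Q.Ω) (b : Fin Q.p → ℝ) : Prop :=
  (∀ j ∉ Q.A, b j = 0) ∧
    ∀ β : Fin Q.p → ℝ, (∀ j ∉ Q.A, β j = 0) → Q.loss ω b ≤ Q.loss ω β

/-- `b` is the unique oracle estimator at the outcome `ω`. -/
def IsUniqueOracle (ω : Q.Ω) (b : Fin Q.p → ℝ) : Prop :=
  Q.IsOracle ω b ∧ ∀ b', Q.IsOracle ω b' → b' = b

/-- The errors have densities between `fmin` and `fmax` on `[-u₀, u₀]`. -/
def DensityBounds (u₀ fmin fmax : ℝ) : Prop :=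
  ∀ i u, |u| ≤ u₀ → fmin ≤ Q.f i u ∧ Q.f i u ≤ fmax

/-- `exp (-x / y)` for `x > 0` and `y ≥ 0`, read as `exp (-∞) = 0` if `y = 0`. -/
def expNegDiv (x y : ℝ) : ℝ := if y = 0 then 0 else Real.exp (-(x / y))

/-- `δ₀ = Pr (‖β^initial - β*‖_max > a₀ λ)` (the norm of `Fin p → ℝ` is the maximum norm). -/
def δ₀ (a₂ lam : ℝ) (init : Q.Ω → Fin Q.p → ℝ) : ℝ :=
  Q.Pr.real {ω | min 1 a₂ * lam < ‖init ω - Q.βstar‖}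

/-- `δ₁^Q`. -/
def δ₁ (a₁ C₁ lam : ℝ) : ℝ :=
  4 * (Q.n : ℝ) ^ (-(1 / 2) : ℝ)
    + C₁ * ((Q.p : ℝ) - Q.s) * expNegDiv (a₁ * Q.n * lam) (104 * Q.mAc)
    + 2 * ((Q.p : ℝ) - Q.s) * expNegDiv (a₁ ^ 2 * Q.n * lam ^ 2) (32 * Q.mAc ^ 2)

/-- `δ₂^Q`. -/
def δ₂ (a fmin lam : ℝ) : ℝ :=
  4 * Real.exp (-(Q.lamMin ^ 2 * fmin ^ 2 / (72 * Q.MA) * ((Q.n : ℝ) / Q.s)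
    * (Q.minSignal - a * lam) ^ 2))

end QuantileModel

end

noncomputable section

/-! ### Elementary inequalities -/

/-! The probabilistic claim rests on a deterministic certificate. Suppose the LLA weights vanish on
the true support and are at least `κ = a₁ λ` off it, and the loss has a subgradient at the oracle
that is zero on the support and smaller than `κ` in absolute value off it. Then the oracle, being
unique, is the only minimizer of the weighted problem (`llaConvergesInTwo_of_subgradient`). The
weights have this form at an initial estimator within `a₀ λ` of the truth, and at the oracle once
its active coordinates are within `d = ‖β*_A‖_min - a λ` of the truth. It remains to localize the
oracle and to bound the off-support gradient there.

Localization (`exists_localization_event`) compares the loss with its value at the truth on a sphere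
of radius `R` in the column space of `X_A`. The mean excess is at least `fmin R² / 2`. Its
fluctuation is controlled by symmetrization and contraction, which reduce the exponential moment of
the supremum to a product of `cosh` over projected coordinate vectors
(`integral_exp_sup'_le_prod_cosh`). The size of the finite index set does not enter, so arbitrarily
fine nets cost nothing, and the exponent involves `dim ≤ s` instead of `n`. The event is used at two
radii: `R² = n λ_min d²` yields `δ₂`, and `R` of order `√(s log n)` yields the `n ^ (-1/2)` term.

On the smaller ball each gradient coordinate is bracketed by a sum of indicators at a net point
(`exists_gradient_event`). The centred sum at the truth obeys Hoeffding's inequality and gives the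
second exponential of `δ₁`. The increment from the truth to the net point has small mean because the
densities are bounded, and a Chernoff bound with a union over the net gives the first exponential.
The growth condition makes the logarithm of the net size and the drift small against `n λ / m_{A^c}`
(`net_budget`). Both signs of each of the `p - s` columns are needed, whence `C₁ = 2`. -/

theorem pow_add_pow_le_of_majorized {A B C D : ℝ} (hD : 0 ≤ D) (hDA : D ≤ A) (hAC : A ≤ C)
    (h : A + B = C + D) (n : ℕ) : A ^ n + B ^ n ≤ C ^ n + D ^ n := by
  have hconv := convexOn_pow (𝕜 := ℝ) n
  rcases eq_or_lt_of_le (hDA.trans hAC) with hCD | hCD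
  · have h1 : A = C := by linarith
    have h2 : B = D := by linarith
    rw [h1, h2]
  have hpos : 0 < C - D := by linarith
  have h0 : 0 ≤ (A - D) / (C - D) := div_nonneg (by linarith) hpos.le
  have h1 : 0 ≤ (C - A) / (C - D) := div_nonneg (by linarith) hpos.le
  have hs : (A - D) / (C - D) + (C - A) / (C - D) = 1 := by field_simp; ring
  have hA := hconv.2 (x := C) (y := D) (by simp; linarith) (by simpa using hD) h0 h1 hs
  have hB := hconv.2 (x := C) (y := D) (by simp; linarith) (by simpa using hD) h1 h0
    (by rw [add_comm]; exact hs)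
  simp only [smul_eq_mul] at hA hB
  have eA : (A - D) / (C - D) * C + (C - A) / (C - D) * D = A := by field_simp; ring
  have eB : (C - A) / (C - D) * C + (A - D) / (C - D) * D = B := by
    field_simp
    have : B = C + D - A := by linarith
    rw [this]; ring
  rw [eA] at hA
  rw [eB] at hB
  calc A ^ n + B ^ n ≤ _ := add_le_add hA hB
    _ = ((A - D) / (C - D) + (C - A) / (C - D)) * (C ^ n + D ^ n) := by ring
    _ = _ := by rw [hs, one_mul]

/-- The series of `cosh` is a power series in the square with nonnegative coefficients, so
majorization between squares can be applied term by term. -/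
theorem cosh_add_cosh_le_of_sq {p q P Q : ℝ} (hQ : Q ^ 2 ≤ p ^ 2) (hP : p ^ 2 ≤ P ^ 2)
    (h : p ^ 2 + q ^ 2 = P ^ 2 + Q ^ 2) :
    Real.cosh p + Real.cosh q ≤ Real.cosh P + Real.cosh Q := by
  refine hasSum_le (fun n => ?_) ((Real.hasSum_cosh p).add (Real.hasSum_cosh q))
    ((Real.hasSum_cosh P).add (Real.hasSum_cosh Q))
  rw [← add_div, ← add_div, pow_mul, pow_mul, pow_mul, pow_mul]
  exact div_le_div_of_nonneg_right
    (pow_add_pow_le_of_majorized (sq_nonneg Q) hQ hP h n) (by positivity)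

/-- The parallelogram law fixes the sum of the two squared norms, and the triangle inequalities keep
them between the squares of `‖v‖ ± ‖x‖`; the collinear case is therefore extremal. Averaging over a
random sign of `x` thus costs a factor `cosh (R‖x‖)`. -/
theorem cosh_norm_add_cosh_norm_le {H : Type*} [NormedAddCommGroup H] [InnerProductSpace ℝ H]
    (v x : H) (R : ℝ) :
    Real.cosh (R * ‖v + x‖) + Real.cosh (R * ‖v - x‖)
      ≤ 2 * (Real.cosh (R * ‖v‖) * Real.cosh (R * ‖x‖)) := by
  have hpar := parallelogram_law_with_norm ℝ v x
  have h1 := abs_norm_sub_norm_le v (-x)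
  rw [norm_neg, sub_neg_eq_add] at h1
  have h2 := norm_add_le v x
  have hsq : (‖v‖ - ‖x‖) ^ 2 ≤ ‖v + x‖ ^ 2 := sq_le_sq' (by linarith [neg_abs_le (‖v‖ - ‖x‖)])
    (le_trans (le_abs_self _) h1)
  have hsq2 : ‖v + x‖ ^ 2 ≤ (‖v‖ + ‖x‖) ^ 2 := by gcongr
  have := cosh_add_cosh_le_of_sq (p := R * ‖v + x‖) (q := R * ‖v - x‖)
    (P := R * ‖v‖ + R * ‖x‖) (Q := R * ‖v‖ - R * ‖x‖)
    (by nlinarith [mul_le_mul_of_nonneg_left hsq (sq_nonneg R)])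
    (by nlinarith [mul_le_mul_of_nonneg_left hsq2 (sq_nonneg R)])
    (by linear_combination R ^ 2 * hpar)
  rw [Real.cosh_add, Real.cosh_sub] at this
  linarith

/-- Weak majorization: the sums are only compared by an inequality, so monotonicity of `exp` is used
along with convexity. -/
theorem exp_add_exp_le_of_majorized {A B C D : ℝ} (hs : A + B ≤ C + D)
    (hA : A ≤ max C D) (hB : B ≤ max C D) :
    Real.exp A + Real.exp B ≤ Real.exp C + Real.exp D := by
  wlog hCD : D ≤ C generalizing C D
  · rw [add_comm (Real.exp C)]
    exact this (by linarith) (by rwa [max_comm]) (by rwa [max_comm]) (by linarith)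
  wlog hAB : B ≤ A generalizing A B
  · rw [add_comm (Real.exp A)]
    exact this (by linarith) hB hA (by linarith)
  rw [max_eq_left hCD] at hA hB
  rcases le_total A D with h | h
  · exact add_le_add (Real.exp_le_exp.2 hA) (Real.exp_le_exp.2 (hAB.trans h))
  have hB' : Real.exp B ≤ Real.exp (C + D - A) := Real.exp_le_exp.2 (by linarith)
  have e : Real.exp (C + D - A) = Real.exp C * Real.exp (D - A) := by
    rw [← Real.exp_add]; ring_nf
  have e2 : Real.exp D = Real.exp A * Real.exp (D - A) := by
    rw [← Real.exp_add]; ring_nf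
  have h3 : Real.exp A ≤ Real.exp C := Real.exp_le_exp.2 hA
  have h4 : Real.exp (D - A) ≤ 1 := Real.exp_le_one_iff.2 (by linarith)
  nlinarith [mul_nonneg (sub_nonneg.2 h3) (sub_nonneg.2 h4)]

/-! ### Contraction and symmetrization for exponential moments of finite maxima -/

section Contraction

variable {ι : Type*} {T : Finset ι} (hT : T.Nonempty)

/-- The contraction principle for a single random sign. With `t`, `t'` maximizing on the left, the
sign of `u t - u t'` decides which of them is tested in which supremum on the right; this compares
the sums, and `h0` compares the maxima. -/
theorem exp_sup'_contraction (h ψ u : ι → ℝ) (h0 : ∀ t ∈ T, |ψ t| ≤ |u t|)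
    (hl : ∀ t ∈ T, ∀ t' ∈ T, |ψ t - ψ t'| ≤ |u t - u t'|) :
    Real.exp (T.sup' hT fun t => h t + ψ t) + Real.exp (T.sup' hT fun t => h t - ψ t)
      ≤ Real.exp (T.sup' hT fun t => h t + u t) + Real.exp (T.sup' hT fun t => h t - u t) := by
  obtain ⟨t, ht, et⟩ := T.exists_mem_eq_sup' hT fun t => h t + ψ t
  obtain ⟨t', ht', et'⟩ := T.exists_mem_eq_sup' hT fun t => h t - ψ t
  rw [et, et']
  have hp : ∀ r ∈ T, h r + u r ≤ T.sup' hT fun t => h t + u t :=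
    fun r hr => Finset.le_sup' (fun t => h t + u t) hr
  have hm : ∀ r ∈ T, h r - u r ≤ T.sup' hT fun t => h t - u t :=
    fun r hr => Finset.le_sup' (fun t => h t - u t) hr
  have habs : ∀ r ∈ T, h r + |u r|
      ≤ max (T.sup' hT fun t => h t + u t) (T.sup' hT fun t => h t - u t) := by
    intro r hr
    rcases abs_cases (u r) with ⟨e, -⟩ | ⟨e, -⟩ <;> rw [e]
    · exact (hp r hr).trans (le_max_left _ _)
    · exact (le_of_eq (by ring)).trans ((hm r hr).trans (le_max_right _ _))
  refine exp_add_exp_le_of_majorized ?_ ?_ ?_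
  · have h1 := (le_abs_self _).trans (hl t ht t' ht')
    have := hp t ht; have := hp t' ht'; have := hm t ht; have := hm t' ht'
    rcases abs_cases (u t - u t') with ⟨e, -⟩ | ⟨e, -⟩ <;> rw [e] at h1 <;> linarith
  · have := habs t ht
    linarith [h0 t ht, le_abs_self (ψ t)]
  · have := habs t' ht'
    linarith [h0 t' ht', neg_abs_le (ψ t')]

theorem measurable_sup'_fun {α : Type*} [MeasurableSpace α] {F : α → ι → ℝ}
    (hF : ∀ t ∈ T, Measurable fun x => F x t) : Measurable fun x => T.sup' hT (F x) := by
  have := Finset.measurable_sup' (f := fun t x => F x t) hT hF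
  convert this using 1
  ext x; rw [Finset.sup'_apply]

theorem exp_sup'_le_of_abs_le {h : ι → ℝ} {u : ι → ℝ} (hu : ∀ t ∈ T, |h t| ≤ u t) :
    Real.exp (T.sup' hT h) ≤ Real.exp (∑ t ∈ T, u t) := by
  refine Real.exp_le_exp.2 (Finset.sup'_le hT _ fun t ht => ?_)
  exact ((le_abs_self _).trans (hu t ht)).trans
    (Finset.single_le_sum (fun r hr => (abs_nonneg _).trans (hu r hr)) ht)

theorem integrable_exp_sup' {α : Type*} [MeasurableSpace α] {μ : Measure α} [IsFiniteMeasure μ]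
    {F : α → ι → ℝ} {u : ι → ℝ} (hF : ∀ t ∈ T, Measurable fun x => F x t)
    (hb : ∀ t ∈ T, ∀ x, |F x t| ≤ u t) :
    Integrable (fun x => Real.exp (T.sup' hT (F x))) μ := by
  refine Integrable.of_bound
    (measurable_sup'_fun hT hF).exp.aestronglyMeasurable (Real.exp (∑ t ∈ T, u t))
    (ae_of_all _ fun x => ?_)
  rw [Real.norm_of_nonneg (Real.exp_pos _).le]
  exact exp_sup'_le_of_abs_le hT fun t ht => hb t ht x

/-- Jensen's inequality introduces an independent copy, swapping the two copies supplies the random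
sign, and contraction replaces the increments by `u`. The hypotheses bound the difference of the two
copies directly, which saves the usual factor two. -/
theorem integral_exp_sup'_symmetrization {α : Type*} [MeasurableSpace α] {μ : Measure α}
    [IsProbabilityMeasure μ] (h u : ι → ℝ) {φ : α → ι → ℝ}
    (hφ : ∀ t ∈ T, Measurable fun x => φ x t) (hb : ∀ t ∈ T, ∀ x, |φ x t| ≤ |u t|)
    (h0 : ∀ x x', ∀ t ∈ T, |φ x' t - φ x t| ≤ |u t|)
    (hl : ∀ x x', ∀ t ∈ T, ∀ t' ∈ T,
      |(φ x' t - φ x t) - (φ x' t' - φ x t')| ≤ |u t - u t'|) :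
    ∫ x, Real.exp (T.sup' hT fun t => h t + ((∫ x', φ x' t ∂μ) - φ x t)) ∂μ
      ≤ (Real.exp (T.sup' hT fun t => h t + u t)
          + Real.exp (T.sup' hT fun t => h t - u t)) / 2 := by
  set F : α × α → ℝ := fun z => Real.exp (T.sup' hT fun t => h t + (φ z.2 t - φ z.1 t)) with hF
  have hφi : ∀ t ∈ T, Integrable (fun x => φ x t) μ := fun t ht =>
    Integrable.of_bound (hφ t ht).aestronglyMeasurable (|u t|) (ae_of_all _ fun x => hb t ht x)
  have hmeas : ∀ t ∈ T, Measurable fun z : α × α => h t + (φ z.2 t - φ z.1 t) := fun t ht =>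
    measurable_const.add (((hφ t ht).comp measurable_snd).sub ((hφ t ht).comp measurable_fst))
  have hbd : ∀ t ∈ T, ∀ z : α × α, |h t + (φ z.2 t - φ z.1 t)| ≤ |h t| + |u t| := fun t ht z =>
    (abs_add_le _ _).trans (add_le_add le_rfl (h0 z.1 z.2 t ht))
  have hFint : Integrable F (μ.prod μ) := integrable_exp_sup' hT hmeas hbd
  have hsec : ∀ x, Integrable (fun x' => F (x, x')) μ := fun x =>
    integrable_exp_sup' hT (F := fun x' t => h t + (φ x' t - φ x t))
      (fun t ht => measurable_const.add ((hφ t ht).sub_const _))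
      (fun t ht x' => hbd t ht (x, x'))
  have hjensen : ∀ x, Real.exp (T.sup' hT fun t => h t + ((∫ x', φ x' t ∂μ) - φ x t))
      ≤ ∫ x', F (x, x') ∂μ := by
    intro x
    obtain ⟨t, ht, et⟩ := T.exists_mem_eq_sup' hT
      fun t => h t + ((∫ x', φ x' t ∂μ) - φ x t)
    rw [et]
    have e : h t + ((∫ x', φ x' t ∂μ) - φ x t) = ∫ x', (h t + (φ x' t - φ x t)) ∂μ := by
      have hi : Integrable (fun x' => φ x' t - φ x t) μ := (hφi t ht).sub (integrable_const _)
      rw [integral_add (integrable_const _) hi, integral_sub (hφi t ht) (integrable_const _)]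
      simp
    rw [e]
    have hexpi : Integrable (fun x' => Real.exp (h t + (φ x' t - φ x t))) μ := by
      refine Integrable.of_bound
        (measurable_const.add ((hφ t ht).sub_const _)).exp.aestronglyMeasurable
        (Real.exp (|h t| + |u t|)) (ae_of_all _ fun x' => ?_)
      rw [Real.norm_of_nonneg (Real.exp_pos _).le]
      exact Real.exp_le_exp.2 ((le_abs_self _).trans (hbd t ht (x, x')))
    refine (convexOn_exp.map_integral_le (μ := μ) (f := fun x' => h t + (φ x' t - φ x t))
      Real.continuous_exp.continuousOn isClosed_univ (by simp)
      ((integrable_const _).add ((hφi t ht).sub (integrable_const _))) hexpi).trans ?_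
    refine integral_mono hexpi (hsec x) fun x' => ?_
    exact Real.exp_le_exp.2 (Finset.le_sup' (fun t => h t + (φ x' t - φ x t)) ht)
  have hstep : ∫ x, Real.exp (T.sup' hT fun t => h t + ((∫ x', φ x' t ∂μ) - φ x t)) ∂μ
      ≤ ∫ z, F z ∂(μ.prod μ) := by
    rw [integral_prod _ hFint]
    refine integral_mono_of_nonneg (ae_of_all _ fun x => (Real.exp_pos _).le)
      hFint.integral_prod_left (ae_of_all _ hjensen)
  have hswap : ∫ z, F z ∂(μ.prod μ) = ∫ z, F z.swap ∂(μ.prod μ) :=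
    (integral_prod_swap (μ := μ) (ν := μ) F).symm
  have hpt : ∀ z, F z + F z.swap ≤ Real.exp (T.sup' hT fun t => h t + u t)
      + Real.exp (T.sup' hT fun t => h t - u t) := by
    intro z
    have := exp_sup'_contraction hT h (fun t => φ z.2 t - φ z.1 t) u (h0 z.1 z.2) (hl z.1 z.2)
    simpa [hF, sub_eq_add_neg, neg_sub, add_comm] using this
  have hsum : ∫ z, (F z + F z.swap) ∂(μ.prod μ) ≤ Real.exp (T.sup' hT fun t => h t + u t)
      + Real.exp (T.sup' hT fun t => h t - u t) := by
    refine (integral_mono (hFint.add hFint.swap) (integrable_const _) hpt).trans ?_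
    simp
  have hFs : Integrable (fun z : α × α => F z.swap) (μ.prod μ) := hFint.swap
  rw [integral_add hFint hFs] at hsum
  have : ∫ z, F z.swap ∂(μ.prod μ) = ∫ z, F z ∂(μ.prod μ) := hswap.symm
  linarith

end Contraction

/-- Integrating out one variable turns its centred term into `± ⟨z i, w⟩`, which is absorbed into
the linear functional; this is why the induction needs a general `v`. When no variable is left, a
linear functional is maximized over a subset of a ball, and `exp ≤ 2 cosh` closes the base case. -/
theorem integral_exp_sup'_le_prod_cosh {H : Type*} [NormedAddCommGroup H] [InnerProductSpace ℝ H]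
    {R : ℝ} {T : Finset H} (hT : T.Nonempty) (hTR : ∀ w ∈ T, ‖w‖ ≤ R) :
    ∀ (n : ℕ) (μ : Fin n → Measure ℝ) [∀ i, IsProbabilityMeasure (μ i)] (z : Fin n → H)
      (φ : Fin n → ℝ → H → ℝ), (∀ i, ∀ w ∈ T, Measurable fun x => φ i x w) →
      (∀ i, ∀ w ∈ T, ∀ x, |φ i x w| ≤ |inner ℝ (z i) w|) →
      (∀ i x x', ∀ w ∈ T, |φ i x' w - φ i x w| ≤ |inner ℝ (z i) w|) →
      (∀ i x x', ∀ w ∈ T, ∀ w' ∈ T,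
        |(φ i x' w - φ i x w) - (φ i x' w' - φ i x w')| ≤ |inner ℝ (z i) w - inner ℝ (z i) w'|) →
      ∀ v : H, ∫ x, Real.exp (T.sup' hT fun w =>
          inner ℝ v w + ∑ i, ((∫ x', φ i x' w ∂(μ i)) - φ i (x i) w)) ∂(Measure.pi μ)
        ≤ 2 * (Real.cosh (R * ‖v‖) * ∏ i, Real.cosh (R * ‖z i‖)) := by
  intro n
  induction n with
  | zero =>
    intro μ _ z φ _ _ _ _ v
    simp only [Finset.univ_eq_empty, Finset.sum_empty, add_zero, Finset.prod_empty, mul_one]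
    rw [integral_const]
    simp only [probReal_univ, one_smul]
    have : Real.exp (T.sup' hT fun w => inner ℝ v w) ≤ Real.exp (R * ‖v‖) := by
      refine Real.exp_le_exp.2 (Finset.sup'_le hT _ fun w hw => ?_)
      refine (real_inner_le_norm v w).trans ?_
      rw [mul_comm]
      exact mul_le_mul_of_nonneg_right (hTR w hw) (norm_nonneg _)
    rw [Real.cosh_eq]
    linarith [Real.exp_pos (-(R * ‖v‖))]
  | succ n ih =>
    intro μ _ z φ hm hb h0 hl v
    set e := (MeasurableEquiv.piFinSuccAbove (fun _ : Fin (n + 1) => ℝ) 0).symm with he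
    have hmp : MeasurePreserving e ((μ 0).prod (Measure.pi fun i : Fin n => μ i.succ))
        (Measure.pi μ) := (measurePreserving_piFinSuccAbove μ 0).symm _
    rw [← hmp.integral_comp' ]
    set ν := Measure.pi fun i : Fin n => μ i.succ with hν
    have hval : ∀ y : ℝ × (Fin n → ℝ), ∀ w,
        inner ℝ v w + ∑ i, ((∫ x', φ i x' w ∂(μ i)) - φ i (e y i) w)
        = (inner ℝ v w + ∑ i : Fin n, ((∫ x', φ i.succ x' w ∂(μ i.succ)) - φ i.succ (y.2 i) w))
          + ((∫ x', φ 0 x' w ∂(μ 0)) - φ 0 y.1 w) := by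
      intro y w
      rw [Fin.sum_univ_succ]
      have h1 : e y 0 = y.1 := by simp [he]
      have h2 : ∀ i : Fin n, e y i.succ = y.2 i := by intro i; simp [he]
      simp only [h1, h2]
      ring
    simp only [hval]
    have hφI : ∀ i, ∀ w ∈ T, |∫ x', φ i x' w ∂(μ i)| ≤ |inner ℝ (z i) w| := by
      intro i w hw
      have := norm_integral_le_of_norm_le_const (μ := μ i) (f := fun x' => φ i x' w)
        (C := |inner ℝ (z i) w|) (ae_of_all _ fun x => hb i w hw x)
      simpa using this
    have hterm : ∀ i, ∀ w ∈ T, ∀ x, |(∫ x', φ i x' w ∂(μ i)) - φ i x w|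
        ≤ 2 * |inner ℝ (z i) w| := by
      intro i w hw x
      have := abs_sub (∫ x', φ i x' w ∂(μ i)) (φ i x w)
      linarith [hφI i w hw, hb i w hw x]
    have hmrest : ∀ w ∈ T, Measurable fun y : Fin n → ℝ =>
        inner ℝ v w + ∑ i : Fin n, ((∫ x', φ i.succ x' w ∂(μ i.succ)) - φ i.succ (y i) w) := by
      intro w hw
      refine measurable_const.add (Finset.measurable_sum _ fun i _ => ?_)
      exact measurable_const.sub ((hm i.succ w hw).comp (measurable_pi_apply i))
    have hbrest : ∀ w ∈ T, ∀ y : Fin n → ℝ,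
        |inner ℝ v w + ∑ i : Fin n, ((∫ x', φ i.succ x' w ∂(μ i.succ)) - φ i.succ (y i) w)|
          ≤ |inner ℝ v w| + ∑ i : Fin n, 2 * |inner ℝ (z i.succ) w| := by
      intro w hw y
      refine (abs_add_le _ _).trans (add_le_add le_rfl ?_)
      refine (Finset.abs_sum_le_sum_abs _ _).trans (Finset.sum_le_sum fun i _ => ?_)
      exact hterm i.succ w hw (y i)
    have hint : Integrable (fun y : ℝ × (Fin n → ℝ) => Real.exp (T.sup' hT fun w =>
        (inner ℝ v w + ∑ i : Fin n, ((∫ x', φ i.succ x' w ∂(μ i.succ)) - φ i.succ (y.2 i) w))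
          + ((∫ x', φ 0 x' w ∂(μ 0)) - φ 0 y.1 w))) ((μ 0).prod ν) := by
      refine integrable_exp_sup' hT
        (u := fun w => (|inner ℝ v w| + ∑ i : Fin n, 2 * |inner ℝ (z i.succ) w|)
          + 2 * |inner ℝ (z 0) w|) (fun w hw => ?_) (fun w hw y => ?_)
      · exact ((hmrest w hw).comp measurable_snd).add
          (measurable_const.sub ((hm 0 w hw).comp measurable_fst))
      · exact (abs_add_le _ _).trans (add_le_add (hbrest w hw y.2) (hterm 0 w hw y.1))
    rw [integral_prod_symm _ hint]
    have hI : ∀ v' : H, Integrable (fun y : Fin n → ℝ => Real.exp (T.sup' hT fun w =>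
        (inner ℝ v' w + ∑ i : Fin n,
          ((∫ x', φ i.succ x' w ∂(μ i.succ)) - φ i.succ (y i) w)))) ν := by
      intro v'
      refine integrable_exp_sup' hT
        (u := fun w => |inner ℝ v' w| + ∑ i : Fin n, 2 * |inner ℝ (z i.succ) w|)
        (fun w hw => ?_) (fun w hw y => ?_)
      · refine measurable_const.add (Finset.measurable_sum _ fun i _ => ?_)
        exact measurable_const.sub ((hm i.succ w hw).comp (measurable_pi_apply i))
      · refine (abs_add_le _ _).trans (add_le_add le_rfl ?_)
        refine (Finset.abs_sum_le_sum_abs _ _).trans (Finset.sum_le_sum fun i _ => ?_)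
        exact hterm i.succ w hw (y i)
    have hstep : ∀ y : Fin n → ℝ, ∫ x, Real.exp (T.sup' hT fun w =>
        (inner ℝ v w + ∑ i : Fin n, ((∫ x', φ i.succ x' w ∂(μ i.succ)) - φ i.succ (y i) w))
          + ((∫ x', φ 0 x' w ∂(μ 0)) - φ 0 x w)) ∂(μ 0)
        ≤ (Real.exp (T.sup' hT fun w => (inner ℝ (v + z 0) w + ∑ i : Fin n,
              ((∫ x', φ i.succ x' w ∂(μ i.succ)) - φ i.succ (y i) w)))
          + Real.exp (T.sup' hT fun w => (inner ℝ (v - z 0) w + ∑ i : Fin n,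
              ((∫ x', φ i.succ x' w ∂(μ i.succ)) - φ i.succ (y i) w)))) / 2 := by
      intro y
      refine (integral_exp_sup'_symmetrization hT _ (fun w => inner ℝ (z 0) w) (hm 0) (hb 0)
        (h0 0) (hl 0)).trans (le_of_eq ?_)
      simp only [inner_add_left, inner_sub_left, add_right_comm, add_sub_right_comm]
    have ihp := ih (fun i => μ i.succ) (fun i => z i.succ) (fun i => φ i.succ)
      (fun i => hm i.succ) (fun i => hb i.succ) (fun i => h0 i.succ) (fun i => hl i.succ)
    calc _ ≤ ∫ y, (Real.exp (T.sup' hT fun w => (inner ℝ (v + z 0) w + ∑ i : Fin n,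
              ((∫ x', φ i.succ x' w ∂(μ i.succ)) - φ i.succ (y i) w)))
          + Real.exp (T.sup' hT fun w => (inner ℝ (v - z 0) w + ∑ i : Fin n,
              ((∫ x', φ i.succ x' w ∂(μ i.succ)) - φ i.succ (y i) w)))) / 2 ∂ν :=
          integral_mono hint.integral_prod_right (((hI _).add (hI _)).div_const 2) hstep
      _ ≤ (2 * (Real.cosh (R * ‖v + z 0‖) * ∏ i : Fin n, Real.cosh (R * ‖z i.succ‖))
          + 2 * (Real.cosh (R * ‖v - z 0‖) * ∏ i : Fin n, Real.cosh (R * ‖z i.succ‖))) / 2 := by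
          rw [integral_div, integral_add (hI _) (hI _)]
          exact div_le_div_of_nonneg_right (add_le_add (ihp _) (ihp _)) (by norm_num)
      _ = (Real.cosh (R * ‖v + z 0‖) + Real.cosh (R * ‖v - z 0‖))
          * ∏ i : Fin n, Real.cosh (R * ‖z i.succ‖) := by ring
      _ ≤ 2 * (Real.cosh (R * ‖v‖) * Real.cosh (R * ‖z 0‖))
          * ∏ i : Fin n, Real.cosh (R * ‖z i.succ‖) := by
          refine mul_le_mul_of_nonneg_right (cosh_norm_add_cosh_norm_le v (z 0) R)
            (Finset.prod_nonneg fun i _ => (Real.cosh_pos _).le)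
      _ = _ := by rw [Fin.prod_univ_succ]; ring

/-! ### Projections of the coordinate vectors onto a subspace -/

section Coordinates

variable {n : ℕ} (W : Submodule ℝ (EuclideanSpace ℝ (Fin n)))

/-- The orthogonal projection of the `i`-th coordinate vector onto `W`. -/
def coordProj (i : Fin n) : W :=
  W.orthogonalProjectionOnto (EuclideanSpace.single i (1 : ℝ))

theorem inner_coordProj (i : Fin n) (w : W) :
    inner ℝ (coordProj W i) w = (w : EuclideanSpace ℝ (Fin n)) i := by
  rw [coordProj, Submodule.inner_orthogonalProjectionOnto_eq_of_mem_right,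
    EuclideanSpace.inner_single_left]
  simp

/-- This is the trace of the orthogonal projection onto `W`; it puts the dimension of `W` into the
deviation exponent. -/
theorem sum_norm_sq_coordProj :
    ∑ i, ‖coordProj W i‖ ^ 2 = Module.finrank ℝ W := by
  set b := stdOrthonormalBasis ℝ W
  have h : ∀ i, ‖coordProj W i‖ ^ 2 = ∑ k, ((b k : EuclideanSpace ℝ (Fin n)) i) ^ 2 := by
    intro i
    rw [← b.sum_sq_norm_inner_right]
    refine Finset.sum_congr rfl fun k _ => ?_
    rw [real_inner_comm, inner_coordProj, Real.norm_eq_abs, sq_abs]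
  simp only [h]
  rw [Finset.sum_comm]
  have h1 : ∀ k, ∑ i, ((b k : EuclideanSpace ℝ (Fin n)) i) ^ 2 = 1 := by
    intro k
    rw [← EuclideanSpace.real_norm_sq_eq]
    have := b.orthonormal.1 k
    rw [Submodule.coe_norm] at this
    rw [this, one_pow]
  simp [h1]

theorem abs_coord_le_norm {n : ℕ} (w : EuclideanSpace ℝ (Fin n)) (i : Fin n) : |w i| ≤ ‖w‖ := by
  have := PiLp.norm_apply_le w i
  simpa using this

theorem sum_abs_coord_le {n : ℕ} (w : EuclideanSpace ℝ (Fin n)) :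
    ∑ i, |w i| ≤ √n * ‖w‖ := by
  have h := Finset.sum_mul_sq_le_sq_mul_sq Finset.univ (fun _ : Fin n => (1 : ℝ)) fun i => |w i|
  simp only [one_mul, one_pow, Finset.sum_const, Finset.card_univ, Fintype.card_fin, nsmul_eq_mul,
    mul_one, sq_abs] at h
  rw [← EuclideanSpace.real_norm_sq_eq] at h
  have h2 : (√n * ‖w‖) ^ 2 = n * ‖w‖ ^ 2 := by
    rw [mul_pow, Real.sq_sqrt (Nat.cast_nonneg n)]
  exact le_of_sq_le_sq (h.trans h2.ge) (by positivity)

end Coordinates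

/-! ### The check loss -/

theorem checkLoss_of_nonneg (τ : ℝ) {u : ℝ} (hu : 0 ≤ u) : checkLoss τ u = τ * u := by
  unfold checkLoss
  split_ifs with h
  · have : u = 0 := le_antisymm h hu
    simp [this]
  · ring

theorem checkLoss_of_nonpos (τ : ℝ) {u : ℝ} (hu : u ≤ 0) : checkLoss τ u = (τ - 1) * u := by
  unfold checkLoss
  rw [if_pos hu]; ring

theorem checkLoss_sub_mem (τ : ℝ) {y z : ℝ} (hyz : y ≤ z) :
    (τ - 1) * (z - y) ≤ checkLoss τ z - checkLoss τ y ∧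
      checkLoss τ z - checkLoss τ y ≤ τ * (z - y) := by
  rcases le_total 0 y with hy | hy
  · rw [checkLoss_of_nonneg τ hy, checkLoss_of_nonneg τ (hy.trans hyz)]
    constructor <;> nlinarith
  rcases le_total 0 z with hz | hz
  · rw [checkLoss_of_nonpos τ hy, checkLoss_of_nonneg τ hz]
    constructor <;> nlinarith
  · rw [checkLoss_of_nonpos τ hy, checkLoss_of_nonpos τ hz]
    constructor <;> nlinarith

theorem measurable_checkLoss (τ : ℝ) : Measurable (checkLoss τ) := by
  unfold checkLoss
  exact measurable_id.mul (measurable_const.sub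
    (Measurable.ite measurableSet_Iic measurable_const measurable_const))

/-- The two increments are taken over intervals of equal length with slopes in `[τ - 1, τ]`, an
interval of length one for every `τ`. -/
theorem abs_checkLoss_second_difference_le (τ x x' u u' : ℝ) :
    |(checkLoss τ (x' - u) - checkLoss τ (x - u)) - (checkLoss τ (x' - u') - checkLoss τ (x - u'))|
      ≤ |u - u'| := by
  wlog h : u ≤ u' generalizing u u'
  · rw [abs_sub_comm, abs_sub_comm u]
    exact this u' u (by linarith)
  have h1 := checkLoss_sub_mem τ (y := x' - u') (z := x' - u) (by linarith)
  have h2 := checkLoss_sub_mem τ (y := x - u') (z := x - u) (by linarith)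
  rw [abs_of_nonpos (by linarith : u - u' ≤ 0), abs_le]
  constructor <;> linarith [h1.1, h1.2, h2.1, h2.2]

theorem abs_checkLoss_sub_le {τ : ℝ} (h0 : 0 ≤ τ) (h1 : τ ≤ 1) (y z : ℝ) :
    |checkLoss τ y - checkLoss τ z| ≤ |y - z| := by
  wlog h : z ≤ y generalizing y z
  · rw [abs_sub_comm, abs_sub_comm y]
    exact this z y (by linarith)
  have := checkLoss_sub_mem τ h
  rw [abs_of_nonneg (by linarith : 0 ≤ y - z), abs_le]
  constructor <;> nlinarith [this.1, this.2]

theorem checkLoss_subgradient (τ : ℝ) {s x : ℝ} (h0 : 0 ≤ s) (h1 : s ≤ 1)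
    (hneg : x < 0 → s = 1) (hpos : 0 < x → s = 0) (δ : ℝ) :
    checkLoss τ x + (s - τ) * δ ≤ checkLoss τ (x - δ) := by
  have key : ∀ z, checkLoss τ z = max (τ * z) ((τ - 1) * z) := by
    intro z
    rcases le_total 0 z with hz | hz
    · rw [checkLoss_of_nonneg τ hz, max_eq_left (by nlinarith)]
    · rw [checkLoss_of_nonpos τ hz, max_eq_right (by nlinarith)]
  have ha := le_max_left (τ * (x - δ)) ((τ - 1) * (x - δ))
  have hb := le_max_right (τ * (x - δ)) ((τ - 1) * (x - δ))
  rw [← key] at ha hb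
  rcases lt_trichotomy x 0 with hx | hx | hx
  · rw [hneg hx, checkLoss_of_nonpos τ hx.le]
    linarith
  · subst hx
    rw [checkLoss_of_nonneg τ le_rfl]
    nlinarith
  · rw [hpos hx, checkLoss_of_nonneg τ hx.le]
    linarith

/-! ### Consequences of density bounds -/

section Density

variable {μ : Measure ℝ} {f : ℝ → ℝ}

theorem smul_volume_restrict_le {c : ℝ} {s : Set ℝ} (hs : MeasurableSet s)
    (hμ : μ = volume.withDensity fun u => ENNReal.ofReal (f u)) (h : ∀ u ∈ s, c ≤ f u) :
    ENNReal.ofReal c • volume.restrict s ≤ μ.restrict s := by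
  rw [hμ, restrict_withDensity hs, ← withDensity_const]
  refine withDensity_mono ?_
  filter_upwards [ae_restrict_mem hs] with u hu
  exact ENNReal.ofReal_le_ofReal (h u hu)

theorem measure_le_of_density_le {c : ℝ} (hc : 0 ≤ c) {x y : ℝ} (hxy : x ≤ y)
    (hμ : μ = volume.withDensity fun u => ENNReal.ofReal (f u)) (h : ∀ u ∈ Set.Icc x y, f u ≤ c) :
    μ.real (Set.Icc x y) ≤ c * (y - x) := by
  have : μ (Set.Icc x y) ≤ ENNReal.ofReal (c * (y - x)) := by
    rw [hμ, withDensity_apply _ measurableSet_Icc, ENNReal.ofReal_mul hc, ← Real.volume_Icc,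
      ← setLIntegral_const]
    exact setLIntegral_mono measurable_const fun u hu => ENNReal.ofReal_le_ofReal (h u hu)
  exact ENNReal.toReal_le_of_le_ofReal (mul_nonneg hc (by linarith)) this

theorem setIntegral_ge_of_density_ge [IsFiniteMeasure μ] {c : ℝ} (hc : 0 ≤ c) {s : Set ℝ}
    (hs : MeasurableSet s) (hμ : μ = volume.withDensity fun u => ENNReal.ofReal (f u))
    (h : ∀ u ∈ s, c ≤ f u) {k : ℝ → ℝ} (hk : ∀ u ∈ s, 0 ≤ k u) (hki : IntegrableOn k s μ) :
    c * ∫ u in s, k u ≤ ∫ u in s, k u ∂μ := by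
  have := integral_mono_measure (smul_volume_restrict_le hs hμ h)
    (by filter_upwards [ae_restrict_mem hs] with u hu using hk u hu) hki
  rwa [integral_smul_measure, ENNReal.toReal_ofReal hc, smul_eq_mul] at this

/-- Knight's identity. The first term has mean zero when `0` is the `τ`-quantile; the remaining
terms are nonnegative and carry the quadratic growth of the mean. -/
theorem checkLoss_sub_eq (τ u x : ℝ) :
    checkLoss τ (x - u) - checkLoss τ x = -u * (τ - (Set.Iic (0 : ℝ)).indicator 1 x)
      + ((Set.Ioc 0 u).indicator (fun x => u - x) x
        + (Set.Ioc u 0).indicator (fun x => x - u) x) := by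
  unfold checkLoss
  simp only [Set.indicator, Set.mem_Iic, Set.mem_Ioc, Pi.one_apply]
  split_ifs <;> first | (exfalso; grind) | ring_nf

theorem integral_checkLoss_sub_ge [IsProbabilityMeasure μ] {τ u₀ fmin u : ℝ} (hfmin : 0 ≤ fmin)
    (hμ : μ = volume.withDensity fun u => ENNReal.ofReal (f u))
    (hq : μ.real (Set.Iic 0) = τ) (hf : ∀ v, |v| ≤ u₀ → fmin ≤ f v) (hu : |u| ≤ u₀) :
    fmin * u ^ 2 / 2 ≤ ∫ x, (checkLoss τ (x - u) - checkLoss τ x) ∂μ := by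
  simp only [checkLoss_sub_eq]
  have hind : Integrable ((Set.Iic (0 : ℝ)).indicator (1 : ℝ → ℝ)) μ :=
    (integrable_const (1 : ℝ)).indicator measurableSet_Iic
  have hi1 : Integrable (fun x => -u * (τ - (Set.Iic (0 : ℝ)).indicator 1 x)) μ :=
    ((integrable_const τ).sub hind).const_mul (-u)
  have hi2 : ∀ a b : ℝ, ∀ k : ℝ → ℝ, Continuous k → IntegrableOn k (Set.Ioc a b) μ := by
    intro a b k hk
    exact (hk.continuousOn.integrableOn_compact isCompact_Icc).mono_set Set.Ioc_subset_Icc_self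
  have hA : IntegrableOn (fun x => u - x) (Set.Ioc 0 u) μ := hi2 0 u _ (by fun_prop)
  have hB : IntegrableOn (fun x => x - u) (Set.Ioc u 0) μ := hi2 u 0 _ (by fun_prop)
  have hA' := (integrable_indicator_iff measurableSet_Ioc).2 hA
  have hB' := (integrable_indicator_iff measurableSet_Ioc).2 hB
  have hAB : Integrable (fun x => (Set.Ioc 0 u).indicator (fun x => u - x) x
      + (Set.Ioc u 0).indicator (fun x => x - u) x) μ := hA'.add hB'
  rw [integral_add hi1 hAB, integral_add hA' hB', integral_indicator measurableSet_Ioc,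
    integral_indicator measurableSet_Ioc, integral_const_mul,
    integral_sub (integrable_const _) hind,
    integral_indicator_one measurableSet_Iic, hq]
  simp only [integral_const, probReal_univ, one_smul, sub_self, mul_zero, zero_add]
  rcases le_total 0 u with h0 | h0
  · rw [Set.Ioc_eq_empty (not_lt.2 h0)]
    have hge := setIntegral_ge_of_density_ge (c := fmin) (s := Set.Ioc 0 u) hfmin
      measurableSet_Ioc hμ
      (fun v hv => hf v (by rw [abs_of_pos hv.1]; exact hv.2.trans ((le_abs_self u).trans hu)))
      (k := fun x => u - x) (fun v hv => by linarith [hv.2]) hA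
    rw [← intervalIntegral.integral_of_le h0] at hge
    have : ∫ x in (0 : ℝ)..u, (u - x) = u ^ 2 / 2 := by
      rw [intervalIntegral.integral_sub (by simp) (by simp)]
      simp
      ring
    rw [this] at hge
    simpa [mul_div_assoc] using hge
  · rw [Set.Ioc_eq_empty (not_lt.2 h0)]
    have hge := setIntegral_ge_of_density_ge (c := fmin) (s := Set.Ioc u 0) hfmin
      measurableSet_Ioc hμ
      (fun v hv => hf v (by
        rw [abs_of_nonpos hv.2]; linarith [hv.1, neg_abs_le u]))
      (k := fun x => x - u) (fun v hv => by linarith [hv.1]) hB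
    rw [← intervalIntegral.integral_of_le h0] at hge
    have : ∫ x in u..(0 : ℝ), (x - u) = u ^ 2 / 2 := by
      rw [intervalIntegral.integral_sub (by simp) (by simp)]
      simp
      ring
    rw [this] at hge
    simpa [mul_div_assoc] using hge

end Density

/-! ### Deviation of the empirical check loss, uniformly over a finite set -/

section Deviation

variable {Ω : Type*} [MeasurableSpace Ω] {Pr : Measure Ω} [IsProbabilityMeasure Pr] {n : ℕ}
  {ε : Fin n → Ω → ℝ}

/-- Markov's inequality for the exponential moment of the supremum, with `cosh x ≤ exp (x² / 2)` and
the trace identity for the projected coordinate vectors. -/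
theorem measureReal_exists_checkLoss_deviation_le {τ : ℝ} (h0 : 0 ≤ τ) (h1 : τ ≤ 1)
    (hε : ∀ i, Measurable (ε i)) (hind : iIndepFun ε Pr)
    (W : Submodule ℝ (EuclideanSpace ℝ (Fin n))) (T : Finset W) {R : ℝ}
    (hTR : ∀ w ∈ T, ‖w‖ ≤ R) {θ : ℝ} (hθ : 0 ≤ θ) (c : ℝ) :
    Pr.real {ω | ∃ w ∈ T, c ≤ ∑ i,
        ((∫ x, (checkLoss τ (x - (w : EuclideanSpace ℝ (Fin n)) i) - checkLoss τ x)
            ∂(Pr.map (ε i)))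
          - (checkLoss τ (ε i ω - (w : EuclideanSpace ℝ (Fin n)) i) - checkLoss τ (ε i ω)))}
      ≤ 2 * Real.exp (-(θ * c) + θ ^ 2 * R ^ 2 * Module.finrank ℝ W / 2) := by
  rcases T.eq_empty_or_nonempty with rfl | hT
  · simp only [Finset.notMem_empty, false_and, exists_false, Set.ofPred_false, measureReal_empty]
    positivity
  set φ : Fin n → ℝ → W → ℝ := fun i x w =>
    θ * (checkLoss τ (x - (w : EuclideanSpace ℝ (Fin n)) i) - checkLoss τ x) with hφ
  have : ∀ i, IsProbabilityMeasure (Pr.map (ε i)) := fun i =>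
    Measure.isProbabilityMeasure_map (hε i).aemeasurable
  have hinner : ∀ i (w : W), inner ℝ (θ • coordProj W i) w
      = θ * (w : EuclideanSpace ℝ (Fin n)) i := by
    intro i w
    exact (real_inner_smul_left (coordProj W i) w θ).trans
      (congrArg (θ * ·) (inner_coordProj W i w))
  have hφm : ∀ i, ∀ w ∈ T, Measurable fun x => φ i x w := fun i w _ =>
    (((measurable_checkLoss τ).comp (measurable_id.sub_const _)).sub
      (measurable_checkLoss τ)).const_mul θ
  have hφb : ∀ i, ∀ w ∈ T, ∀ x, |φ i x w| ≤ |inner ℝ (θ • coordProj W i) w| := by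
    intro i w _ x
    rw [hinner, hφ, abs_mul, abs_mul]
    refine mul_le_mul_of_nonneg_left ?_ (abs_nonneg _)
    refine (abs_checkLoss_sub_le h0 h1 _ _).trans (le_of_eq ?_)
    rw [sub_sub_cancel_left, abs_neg]
  have hφl : ∀ i x x', ∀ w ∈ T, ∀ w' ∈ T, |(φ i x' w - φ i x w) - (φ i x' w' - φ i x w')|
      ≤ |inner ℝ (θ • coordProj W i) w - inner ℝ (θ • coordProj W i) w'| := by
    intro i x x' w _ w' _
    have e : (φ i x' w - φ i x w) - (φ i x' w' - φ i x w') = θ *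
        ((checkLoss τ (x' - (w : EuclideanSpace ℝ (Fin n)) i)
          - checkLoss τ (x - (w : EuclideanSpace ℝ (Fin n)) i))
        - (checkLoss τ (x' - (w' : EuclideanSpace ℝ (Fin n)) i)
          - checkLoss τ (x - (w' : EuclideanSpace ℝ (Fin n)) i))) := by
      simp only [hφ]; ring
    rw [e, abs_mul, hinner, hinner, ← mul_sub, abs_mul]
    exact mul_le_mul_of_nonneg_left (abs_checkLoss_second_difference_le τ _ _ _ _) (abs_nonneg _)
  have hφ0 : ∀ i x x', ∀ w ∈ T, |φ i x' w - φ i x w| ≤ |inner ℝ (θ • coordProj W i) w| := by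
    intro i x x' w _
    have h := abs_checkLoss_second_difference_le τ x x' ((w : EuclideanSpace ℝ (Fin n)) i) 0
    rw [hinner, abs_mul]
    have e : φ i x' w - φ i x w = θ *
        ((checkLoss τ (x' - (w : EuclideanSpace ℝ (Fin n)) i)
          - checkLoss τ (x - (w : EuclideanSpace ℝ (Fin n)) i))
        - (checkLoss τ (x' - 0) - checkLoss τ (x - 0))) := by
      simp only [hφ, sub_zero]; ring
    rw [e, abs_mul]
    rw [sub_zero ((w : EuclideanSpace ℝ (Fin n)) i)] at h
    exact mul_le_mul_of_nonneg_left h (abs_nonneg _)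
  have hmain := integral_exp_sup'_le_prod_cosh hT hTR n (fun i => Pr.map (ε i))
    (fun i => θ • coordProj W i) φ hφm hφb hφ0 hφl 0
  simp only [inner_zero_left, zero_add, norm_zero, mul_zero, Real.cosh_zero, one_mul] at hmain
  set G : (Fin n → ℝ) → ℝ := fun x => Real.exp (T.sup' hT fun w =>
    ∑ i, ((∫ x', φ i x' w ∂(Pr.map (ε i))) - φ i (x i) w)) with hG
  have hGm : Measurable G := by
    refine (measurable_sup'_fun hT fun w hw => ?_).exp
    refine Finset.measurable_sum _ fun i _ => ?_
    exact measurable_const.sub ((hφm i w hw).comp (measurable_pi_apply i))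
  have hGb : ∀ x, G x ≤ Real.exp (∑ w ∈ T, ∑ i, 2 * |inner ℝ (θ • coordProj W i) w|) := by
    intro x
    refine exp_sup'_le_of_abs_le hT fun w hw => ?_
    refine (Finset.abs_sum_le_sum_abs _ _).trans (Finset.sum_le_sum fun i _ => ?_)
    have h2 := norm_integral_le_of_norm_le_const (μ := Pr.map (ε i)) (f := fun x' => φ i x' w)
      (C := |inner ℝ (θ • coordProj W i) w|) (ae_of_all _ fun x => hφb i w hw x)
    simp only [probReal_univ, mul_one, Real.norm_eq_abs] at h2
    have h3 := abs_sub (∫ x', φ i x' w ∂(Pr.map (ε i))) (φ i (x i) w)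
    linarith [hφb i w hw (x i)]
  have hmap := (iIndepFun_iff_map_fun_eq_pi_map fun i => (hε i).aemeasurable).1 hind
  have hεm : Measurable fun ω i => ε i ω := measurable_pi_lambda _ hε
  rw [← hmap, integral_map hεm.aemeasurable hGm.aestronglyMeasurable] at hmain
  have hprod : ∏ i, Real.cosh (R * ‖θ • coordProj W i‖)
      ≤ Real.exp (θ ^ 2 * R ^ 2 * Module.finrank ℝ W / 2) := by
    rw [← sum_norm_sq_coordProj W, Finset.mul_sum, Finset.sum_div, Real.exp_sum]
    refine Finset.prod_le_prod (fun i _ => (Real.cosh_pos _).le) fun i _ => ?_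
    refine (Real.cosh_le_exp_half_sq _).trans (le_of_eq ?_)
    rw [norm_smul, Real.norm_eq_abs, mul_pow, mul_pow, sq_abs]
    ring_nf
  have hmarkov := mul_meas_ge_le_integral_of_nonneg (μ := Pr) (f := fun ω => G fun i => ε i ω)
    (ae_of_all _ fun ω => (Real.exp_pos _).le)
    (Integrable.of_bound (hGm.comp hεm).aestronglyMeasurable _ (ae_of_all _ fun ω => by
      rw [Real.norm_of_nonneg (Real.exp_pos _).le]; exact hGb _)) (Real.exp (θ * c))
  have hsub : {ω | ∃ w ∈ T, c ≤ ∑ i,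
        ((∫ x, (checkLoss τ (x - (w : EuclideanSpace ℝ (Fin n)) i) - checkLoss τ x)
            ∂(Pr.map (ε i)))
          - (checkLoss τ (ε i ω - (w : EuclideanSpace ℝ (Fin n)) i) - checkLoss τ (ε i ω)))}
      ⊆ {ω | Real.exp (θ * c) ≤ G fun i => ε i ω} := by
    rintro ω ⟨w, hw, hc⟩
    refine Real.exp_le_exp.2 ?_
    refine le_trans ?_ (Finset.le_sup' (fun w =>
      ∑ i, ((∫ x', φ i x' w ∂(Pr.map (ε i))) - φ i (ε i ω) w)) hw)
    simp only [hφ, integral_const_mul, ← mul_sub, ← Finset.mul_sum]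
    exact mul_le_mul_of_nonneg_left hc hθ
  have hle := measureReal_mono (μ := Pr) hsub
  have hpos := Real.exp_pos (θ * c)
  rw [Real.exp_add, Real.exp_neg, ← mul_assoc, mul_comm (2 : ℝ), mul_assoc, inv_mul_eq_div,
    le_div_iff₀ hpos]
  calc _ ≤ Pr.real {ω | Real.exp (θ * c) ≤ G fun i => ε i ω} * Real.exp (θ * c) :=
        mul_le_mul_of_nonneg_right hle hpos.le
    _ ≤ 2 * ∏ i, Real.cosh (R * ‖θ • coordProj W i‖) := by
        rw [mul_comm]; exact hmarkov.trans hmain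
    _ ≤ _ := mul_le_mul_of_nonneg_left hprod (by norm_num)

end Deviation

/-- Convexity, obtained by averaging the subgradient inequality at `x - t * u` over the two
endpoints. -/
theorem checkLoss_sub_mul_le {τ t : ℝ} (h0 : 0 ≤ t) (h1 : t ≤ 1) (x u : ℝ) :
    checkLoss τ (x - t * u) - checkLoss τ x ≤ t * (checkLoss τ (x - u) - checkLoss τ x) := by
  have key := checkLoss_subgradient τ (x := x - t * u)
    (s := if x - t * u ≤ 0 then 1 else 0) (by split_ifs <;> norm_num) (by split_ifs <;> norm_num)
    (fun h => by rw [if_pos h.le]) (fun h => by rw [if_neg (not_le.2 h)])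
  have ha := key (-(t * u))
  have hb := key ((1 - t) * u)
  rw [show x - t * u - -(t * u) = x by ring] at ha
  rw [show x - t * u - (1 - t) * u = x - u by ring] at hb
  nlinarith [mul_le_mul_of_nonneg_left ha (by linarith : 0 ≤ 1 - t),
    mul_le_mul_of_nonneg_left hb h0]

/-! ### Localization of near-minimizers of the check loss -/

namespace QuantileModel

variable {τ : ℝ} (Q : QuantileModel τ)

theorem measureReal_map_Iic (i : Fin Q.n) : (Q.Pr.map (Q.ε i)).real (Set.Iic 0) = τ := by
  rw [map_measureReal_apply (Q.measurable_ε i) measurableSet_Iic]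
  exact Q.quantile i

instance (i : Fin Q.n) : IsProbabilityMeasure (Q.Pr.map (Q.ε i)) :=
  Measure.isProbabilityMeasure_map (Q.measurable_ε i).aemeasurable

theorem sum_integral_checkLoss_ge {u₀ fmin fmax : ℝ} (hfmin : 0 ≤ fmin)
    (hb : Q.DensityBounds u₀ fmin fmax) (w : EuclideanSpace ℝ (Fin Q.n)) (hw : ∀ i, |w i| ≤ u₀) :
    fmin * ‖w‖ ^ 2 / 2
      ≤ ∑ i, ∫ x, (checkLoss τ (x - w i) - checkLoss τ x) ∂(Q.Pr.map (Q.ε i)) := by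
  rw [EuclideanSpace.real_norm_sq_eq, Finset.mul_sum, Finset.sum_div]
  exact Finset.sum_le_sum fun i _ => integral_checkLoss_sub_ge hfmin (Q.density i)
    (Q.measureReal_map_Iic i) (fun v hv => (hb i v hv).1) (hw i)

/-- A violating `w` outside the ball can be shrunk by convexity to a point of the sphere with
nonpositive excess. A nearby net point then has excess at most `c`, while its mean excess is at
least `2 c`: a deviation of size `c`. -/
theorem exists_localization_event (hτ : τ ∈ Set.Ioo (0 : ℝ) 1) {u₀ fmin fmax : ℝ}
    (hfmin : 0 < fmin) (hb : Q.DensityBounds u₀ fmin fmax)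
    (W : Submodule ℝ (EuclideanSpace ℝ (Fin Q.n))) {s : ℕ} (hs : 0 < s)
    (hW : Module.finrank ℝ W ≤ s) {R : ℝ} (hR : 0 < R) :
    ∃ N : Set Q.Ω, MeasurableSet N ∧
      Q.Pr.real N ≤ 2 * Real.exp (-(fmin ^ 2 * R ^ 2 / (32 * s))) ∧
      ∀ ω ∉ N, ∀ w ∈ W, (∀ i, |w i| ≤ u₀) →
        ∑ i, (checkLoss τ (Q.ε i ω - w i) - checkLoss τ (Q.ε i ω)) ≤ 0 → ‖w‖ < R := by
  set S : Set W := {w | ‖w‖ = R ∧ ∀ i, |(w : EuclideanSpace ℝ (Fin Q.n)) i| ≤ u₀} with hS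
  have hScomp : IsCompact S := by
    refine (isCompact_sphere (0 : W) R).of_isClosed_subset ?_ fun w hw => by simpa using hw.1
    refine IsClosed.inter (isClosed_eq continuous_norm continuous_const) ?_
    have : {w : W | ∀ i, |(w : EuclideanSpace ℝ (Fin Q.n)) i| ≤ u₀}
        = ⋂ i, {w : W | |(w : EuclideanSpace ℝ (Fin Q.n)) i| ≤ u₀} := by ext; simp
    change IsClosed {w : W | ∀ i, |(w : EuclideanSpace ℝ (Fin Q.n)) i| ≤ u₀}
    rw [this]
    exact isClosed_iInter fun i => isClosed_le (by fun_prop) continuous_const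
  set c : ℝ := fmin * R ^ 2 / 4 with hc
  have hcpos : 0 < c := by positivity
  -- By Cauchy–Schwarz this mesh changes the total loss by at most `√n * mesh ≤ c`; the `+ 1` keeps
  -- the denominator positive when `n = 0`.
  obtain ⟨T, hTS, hTfin, hTcov⟩ := hScomp.finite_cover_balls (e := c / (√Q.n + 1)) (by positivity)
  set T' := hTfin.toFinset with hT'
  set B : Set Q.Ω := {ω | ∃ w ∈ T', c ≤ ∑ i,
        ((∫ x, (checkLoss τ (x - (w : EuclideanSpace ℝ (Fin Q.n)) i) - checkLoss τ x)
            ∂(Q.Pr.map (Q.ε i)))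
          - (checkLoss τ (Q.ε i ω - (w : EuclideanSpace ℝ (Fin Q.n)) i)
              - checkLoss τ (Q.ε i ω)))} with hB
  have hdev := measureReal_exists_checkLoss_deviation_le (Pr := Q.Pr) hτ.1.le hτ.2.le
    Q.measurable_ε Q.indep W T' (R := R) (fun w hw => (hTS (hTfin.mem_toFinset.1 hw)).1.le)
    -- This `θ` minimizes `-θ c + θ² R² s / 2`.
    (θ := fmin / (4 * s)) (by positivity) c
  have hs' : (0 : ℝ) < s := Nat.cast_pos.2 hs
  have hW' : (Module.finrank ℝ W : ℝ) ≤ s := Nat.cast_le.2 hW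
  refine ⟨toMeasurable Q.Pr B, measurableSet_toMeasurable _ _, ?_, ?_⟩
  · rw [measureReal_def, measure_toMeasurable, ← measureReal_def]
    refine hdev.trans (mul_le_mul_of_nonneg_left (Real.exp_le_exp.2 ?_) (by norm_num))
    calc -(fmin / (4 * s) * c) + (fmin / (4 * s)) ^ 2 * R ^ 2 * Module.finrank ℝ W / 2
        ≤ -(fmin / (4 * s) * c) + (fmin / (4 * s)) ^ 2 * R ^ 2 * s / 2 := by gcongr
      _ = -(fmin ^ 2 * R ^ 2 / (32 * s)) := by rw [hc]; field_simp; ring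
  · intro ω hω w hw hwu hle
    by_contra hcon
    rw [not_lt] at hcon
    have hω' : ω ∉ B := fun h => hω (subset_toMeasurable _ _ h)
    have hwpos : 0 < ‖w‖ := hR.trans_le hcon
    set t := R / ‖w‖ with ht
    have ht0 : 0 ≤ t := by positivity
    have ht1 : t ≤ 1 := (div_le_one hwpos).2 hcon
    set v : W := t • ⟨w, hw⟩ with hv
    have hvi : ∀ i, (v : EuclideanSpace ℝ (Fin Q.n)) i = t * w i := fun i => rfl
    have hvS : v ∈ S := by
      refine ⟨?_, fun i => ?_⟩
      · change ‖t • w‖ = R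
        rw [norm_smul, Real.norm_of_nonneg ht0, ht, div_mul_cancel₀ _ hwpos.ne']
      · rw [hvi, abs_mul, abs_of_nonneg ht0]
        exact (mul_le_of_le_one_left (abs_nonneg _) ht1).trans (hwu i)
    have hvle : ∑ i, (checkLoss τ (Q.ε i ω - (v : EuclideanSpace ℝ (Fin Q.n)) i)
        - checkLoss τ (Q.ε i ω)) ≤ 0 := by
      have : ∑ i, (checkLoss τ (Q.ε i ω - (v : EuclideanSpace ℝ (Fin Q.n)) i)
          - checkLoss τ (Q.ε i ω))
          ≤ t * ∑ i, (checkLoss τ (Q.ε i ω - w i) - checkLoss τ (Q.ε i ω)) := by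
        rw [Finset.mul_sum]
        refine Finset.sum_le_sum fun i _ => ?_
        rw [hvi]
        exact checkLoss_sub_mul_le ht0 ht1 _ _
      exact this.trans (mul_nonpos_of_nonneg_of_nonpos ht0 hle)
    obtain ⟨x, hxT, hvx⟩ := Set.mem_iUnion₂.1 (hTcov hvS)
    refine hω' ⟨x, hTfin.mem_toFinset.2 hxT, ?_⟩
    have hxS := hTS hxT
    have hE := Q.sum_integral_checkLoss_ge hfmin.le hb (x : EuclideanSpace ℝ (Fin Q.n)) hxS.2
    have hnx : ‖(x : EuclideanSpace ℝ (Fin Q.n))‖ = R := hxS.1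
    rw [hnx] at hE
    have hdist : ‖(v : EuclideanSpace ℝ (Fin Q.n)) - x‖ < c / (√Q.n + 1) := by
      rw [Metric.mem_ball, dist_eq_norm] at hvx
      exact hvx
    have hlip : ∑ i, (checkLoss τ (Q.ε i ω - (x : EuclideanSpace ℝ (Fin Q.n)) i)
        - checkLoss τ (Q.ε i ω - (v : EuclideanSpace ℝ (Fin Q.n)) i)) ≤ c := by
      calc _ ≤ ∑ i, |((v : EuclideanSpace ℝ (Fin Q.n)) - x) i| := by
            refine Finset.sum_le_sum fun i _ => ?_
            refine (le_abs_self _).trans ((abs_checkLoss_sub_le hτ.1.le hτ.2.le _ _).trans ?_)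
            refine le_of_eq (congrArg _ ?_)
            rw [PiLp.sub_apply]; ring
        _ ≤ √Q.n * (c / (√Q.n + 1)) := (sum_abs_coord_le _).trans
            (mul_le_mul_of_nonneg_left hdist.le (Real.sqrt_nonneg _))
        _ ≤ c := by
            rw [mul_div_assoc', div_le_iff₀ (by positivity)]
            nlinarith [Real.sqrt_nonneg (Q.n : ℝ)]
    have hx : ∑ i, (checkLoss τ (Q.ε i ω - (x : EuclideanSpace ℝ (Fin Q.n)) i)
        - checkLoss τ (Q.ε i ω)) ≤ c := by
      have := add_le_add hlip hvle
      rw [← Finset.sum_add_distrib] at this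
      simpa using this
    rw [Finset.sum_sub_distrib]
    have : fmin * R ^ 2 / 2 = c + c := by rw [hc]; ring
    linarith

end QuantileModel

/-! ### Subgradients at minimizers of the check loss over a subspace -/

/-- The loss is piecewise linear, so its one-sided derivative is exact for small `t`; at the kink
the sign of `c` selects the slope. -/
theorem eventually_checkLoss_sub_mul_eq (τ e c : ℝ) :
    ∀ᶠ t in 𝓝[>] (0 : ℝ), checkLoss τ (e - t * c) = checkLoss τ e
      + t * (((if 0 < c then (if e ≤ 0 then 1 else 0) else (if e < 0 then 1 else 0)) - τ) * c) := by
  have hlim : Tendsto (fun t : ℝ => e - t * c) (𝓝[>] 0) (𝓝 e) := by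
    have : Continuous fun t : ℝ => e - t * c := by fun_prop
    simpa using (this.tendsto 0).mono_left nhdsWithin_le_nhds
  rcases lt_trichotomy e 0 with he | he | he
  · filter_upwards [hlim.eventually (gt_mem_nhds he)] with t ht
    rw [checkLoss_of_nonpos τ ht.le, checkLoss_of_nonpos τ he.le]
    simp only [he, he.le, if_true, ite_self]
    ring
  · subst he
    filter_upwards [self_mem_nhdsWithin] with t ht
    rw [Set.mem_Ioi] at ht
    rw [checkLoss_of_nonneg τ le_rfl]
    split_ifs with h1 h2 h2
    · rw [checkLoss_of_nonpos τ (by nlinarith)]; ring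
    · exact absurd le_rfl h2
    · exact absurd h2 (lt_irrefl _)
    · rw [checkLoss_of_nonneg τ (by nlinarith)]; ring
  · filter_upwards [hlim.eventually (lt_mem_nhds he)] with t ht
    rw [checkLoss_of_nonneg τ ht.le, checkLoss_of_nonneg τ he.le]
    simp only [not_le.2 he, not_lt.2 he.le, if_false, ite_self]
    ring

/-- If the box of coordinatewise subgradients missed the orthogonal complement of `W`, Hahn–Banach
would produce a functional negative on the box and zero on the complement. Its coefficient vector
would lie in `W` and be a descent direction. -/
theorem exists_subgradient_of_isMin {n : ℕ} {τ : ℝ}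
    (W : Submodule ℝ (EuclideanSpace ℝ (Fin n))) (e : Fin n → ℝ)
    (hmin : ∀ w ∈ W, ∑ i, checkLoss τ (e i) ≤ ∑ i, checkLoss τ (e i - w i)) :
    ∃ s : Fin n → ℝ, (∀ i, 0 ≤ s i ∧ s i ≤ 1 ∧ (e i < 0 → s i = 1) ∧ (0 < e i → s i = 0)) ∧
      ∀ w ∈ W, ∑ i, (s i - τ) * w i = 0 := by
  set lo : Fin n → ℝ := fun i => (if e i < 0 then 1 else 0) - τ with hlo
  set hi : Fin n → ℝ := fun i => (if e i ≤ 0 then 1 else 0) - τ with hhi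
  set N : Submodule ℝ (Fin n → ℝ) :=
    Wᗮ.comap (WithLp.linearEquiv 2 ℝ (Fin n → ℝ)).symm.toLinearMap with hN
  have hlohi : lo ≤ hi := by
    intro i
    simp only [hlo, hhi]
    split_ifs <;> linarith
  by_cases hdisj : Disjoint (Set.Icc lo hi) (N : Set (Fin n → ℝ))
  · exfalso
    obtain ⟨f, u, v, hfu, huv, hfv⟩ := geometric_hahn_banach_compact_closed (convex_Icc lo hi)
      isCompact_Icc N.convex N.closed_of_finiteDimensional hdisj
    have hv0 : v < 0 := by simpa using hfv 0 N.zero_mem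
    have hfN : ∀ x ∈ N, f x = 0 := by
      intro x hx
      by_contra hne
      have := hfv ((v / f x) • x) (N.smul_mem _ hx)
      rw [map_smul, smul_eq_mul, div_mul_cancel₀ _ hne] at this
      exact lt_irrefl _ this
    set c : Fin n → ℝ := fun i => f (Pi.single i 1) with hc
    have hfc : ∀ x, f x = ∑ i, x i * c i := by
      intro x
      conv_lhs => rw [← Finset.univ_sum_single x]
      rw [map_sum]
      refine Finset.sum_congr rfl fun i _ => ?_
      rw [hc, ← smul_eq_mul, ← map_smul]
      congr 1
      rw [← Pi.single_smul]; simp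
    have hcW : WithLp.toLp 2 c ∈ W := by
      rw [← Submodule.orthogonal_orthogonal W, Submodule.mem_orthogonal]
      intro y hy
      have h1 : (y.ofLp : Fin n → ℝ) ∈ N := by
        rw [hN, Submodule.mem_comap]; exact hy
      have h2 := hfN _ h1
      rw [hfc] at h2
      rw [PiLp.inner_apply]
      simpa [mul_comm] using h2
    -- The vertex of the box maximizing `f`: there `f` equals the right derivative of the loss in
    -- direction `c`.
    set x : Fin n → ℝ := fun i => if 0 < c i then hi i else lo i with hx
    have hxK : x ∈ Set.Icc lo hi := by
      constructor <;> intro i <;> simp only [hx] <;> split_ifs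
      · exact hlohi i
      · exact le_rfl
      · exact le_rfl
      · exact hlohi i
    have hfx := hfu x hxK
    have hev : ∀ᶠ t in 𝓝[>] (0 : ℝ), ∀ i, checkLoss τ (e i - t * c i) = checkLoss τ (e i)
        + t * (x i * c i) := by
      refine eventually_all.2 fun i => ?_
      filter_upwards [eventually_checkLoss_sub_mul_eq τ (e i) (c i)] with t ht
      rw [ht]
      simp only [hx, hhi, hlo]
      split_ifs <;> rfl
    obtain ⟨t, ht, ht0⟩ := (hev.and self_mem_nhdsWithin).exists
    have hm := hmin (t • WithLp.toLp 2 c) (W.smul_mem _ hcW)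
    have e1 : ∀ i, (t • WithLp.toLp 2 c : EuclideanSpace ℝ (Fin n)) i = t * c i := fun i => rfl
    simp only [e1, ht, Finset.sum_add_distrib, ← Finset.mul_sum, ← hfc] at hm
    nlinarith
  · obtain ⟨x, hxK, hxN⟩ := Set.not_disjoint_iff.1 hdisj
    refine ⟨fun i => x i + τ, fun i => ?_, fun w hw => ?_⟩
    · have h1 := hxK.1 i
      have h2 := hxK.2 i
      simp only [hlo, hhi] at h1 h2
      refine ⟨?_, ?_, fun he => ?_, fun he => ?_⟩
      · split_ifs at h1 <;> linarith
      · split_ifs at h2 <;> linarith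
      · rw [if_pos he] at h1; rw [if_pos he.le] at h2; linarith
      · rw [if_neg (not_lt.2 he.le)] at h1; rw [if_neg (not_le.2 he)] at h2; linarith
    · have h1 : WithLp.toLp 2 x ∈ Wᗮ := hxN
      have h2 := (Submodule.mem_orthogonal W _).1 h1 w hw
      rw [PiLp.inner_apply] at h2
      simpa [mul_comm] using h2

/-! ### Tail bounds for weighted sums of indicators -/

section Tails

variable {Ω : Type*} [MeasurableSpace Ω] {Pr : Measure Ω} [IsProbabilityMeasure Pr] {n : ℕ}
  {ε : Fin n → Ω → ℝ}

/-- Chernoff at the fixed parameter `1 / m`: the exponents `y` have absolute value at most one, so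
`exp y ≤ 1 + y + y² ≤ 1 + 2 |ξ|`. The bound profits from first moments `v i` that are small, as for
differences of indicators with close thresholds. -/
theorem measureReal_sum_mul_ge_le (hε : ∀ i, Measurable (ε i)) (hind : iIndepFun ε Pr)
    {m : ℝ} (hm : 0 < m) {c : Fin n → ℝ} (hc : ∀ i, |c i| ≤ m) {ξ : Fin n → ℝ → ℝ}
    (hξm : ∀ i, Measurable (ξ i)) (hξ : ∀ i x, |ξ i x| ≤ 1) {v : Fin n → ℝ}
    (hv : ∀ i, ∫ ω, |ξ i (ε i ω)| ∂Pr ≤ v i) (t : ℝ) :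
    Pr.real {ω | t ≤ ∑ i, c i * ξ i (ε i ω)} ≤ Real.exp (-(t / m) + 2 * ∑ i, v i) := by
  set X : Fin n → Ω → ℝ := fun i ω => c i * ξ i (ε i ω) with hX
  have hXm : ∀ i, Measurable (X i) := fun i => ((hξm i).comp (hε i)).const_mul _
  have hXind : iIndepFun X Pr :=
    hind.comp (fun i x => c i * ξ i x) fun i => (hξm i).const_mul _
  have hb : ∀ i ω, |1 / m * X i ω| ≤ 1 := by
    intro i ω
    rw [abs_mul, abs_of_pos (by positivity : 0 < 1 / m), hX, abs_mul, one_div_mul_eq_div,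
      div_le_one hm]
    calc |c i| * |ξ i (ε i ω)| ≤ m * 1 := mul_le_mul (hc i) (hξ i _) (abs_nonneg _) hm.le
      _ = m := mul_one m
  have habs : ∀ i ω, |1 / m * X i ω| ≤ |ξ i (ε i ω)| := by
    intro i ω
    rw [abs_mul, abs_of_pos (by positivity : 0 < 1 / m), hX, abs_mul, one_div_mul_eq_div,
      div_le_iff₀ hm, mul_comm]
    exact mul_le_mul_of_nonneg_left (hc i) (abs_nonneg _)
  have hmgf : ∀ i, mgf (X i) Pr (1 / m) ≤ Real.exp (2 * v i) := by
    intro i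
    have hint : Integrable (fun ω => |ξ i (ε i ω)|) Pr :=
      Integrable.of_bound ((hξm i).comp (hε i)).abs.aestronglyMeasurable 1
        (ae_of_all _ fun ω => by rw [Real.norm_eq_abs, abs_abs]; exact hξ i _)
    calc mgf (X i) Pr (1 / m) ≤ ∫ ω, (1 + 2 * |ξ i (ε i ω)|) ∂Pr := by
          refine integral_mono_of_nonneg (ae_of_all _ fun ω => (Real.exp_pos _).le)
            ((integrable_const _).add (hint.const_mul 2)) (ae_of_all _ fun ω => ?_)
          have h1 := Real.abs_exp_sub_one_sub_id_le (hb i ω)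
          have h2 := (abs_le.1 h1).2
          have h3 : (1 / m * X i ω) ^ 2 ≤ |ξ i (ε i ω)| := by
            rw [← sq_abs, sq]
            calc _ ≤ |1 / m * X i ω| * 1 := mul_le_mul_of_nonneg_left (hb i ω) (abs_nonneg _)
              _ ≤ _ := by rw [mul_one]; exact habs i ω
          have h4 := (le_abs_self _).trans (habs i ω)
          change Real.exp (1 / m * X i ω) ≤ _
          linarith
      _ = 1 + 2 * ∫ ω, |ξ i (ε i ω)| ∂Pr := by
          rw [integral_add (integrable_const _) (hint.const_mul 2), integral_const_mul]
          simp
      _ ≤ 2 * v i + 1 := by linarith [hv i]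
      _ ≤ Real.exp (2 * v i) := Real.add_one_le_exp _
  have hsm : Measurable (∑ i, X i) := by
    have := Finset.measurable_sum Finset.univ fun i _ => hXm i
    convert this using 1
    ext ω; exact Finset.sum_apply ω _ _
  have hch := measure_ge_le_exp_mul_mgf (μ := Pr) (X := ∑ i, X i) (t := 1 / m) t (by positivity)
    (Integrable.of_bound (hsm.const_mul _).exp.aestronglyMeasurable (Real.exp (∑ _i : Fin n, 1))
      (ae_of_all _ fun ω => by
        rw [Real.norm_of_nonneg (Real.exp_pos _).le, Finset.sum_apply, Finset.mul_sum]
        exact Real.exp_le_exp.2 (Finset.sum_le_sum fun i _ => (le_abs_self _).trans (hb i ω))))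
  rw [hXind.mgf_sum hXm] at hch
  have hprod : ∏ i, mgf (X i) Pr (1 / m) ≤ Real.exp (2 * ∑ i, v i) := by
    rw [Finset.mul_sum, Real.exp_sum]
    exact Finset.prod_le_prod (fun i _ => mgf_nonneg) fun i _ => hmgf i
  have e : {ω | t ≤ ∑ i, c i * ξ i (ε i ω)} = {ω | t ≤ (∑ i, X i) ω} := by
    ext ω; simp [hX, Finset.sum_apply]
  rw [e, Real.exp_add]
  refine hch.trans ?_
  rw [show -(1 / m) * t = -(t / m) by ring]
  exact mul_le_mul_of_nonneg_left hprod (Real.exp_pos _).le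

theorem measureReal_sum_indicator_sub_ge_le {τ : ℝ} (hε : ∀ i, Measurable (ε i))
    (hind : iIndepFun ε Pr) (hq : ∀ i, Pr.real {ω | ε i ω ≤ 0} = τ)
    {m : ℝ} (hm : 0 < m) {c : Fin n → ℝ} (hc : ∀ i, |c i| ≤ m) {t : ℝ} (ht : 0 ≤ t) :
    Pr.real {ω | t ≤ ∑ i, c i * ((Set.Iic (0 : ℝ)).indicator 1 (ε i ω) - τ)}
      ≤ Real.exp (-(2 * t ^ 2 / (n * m ^ 2))) := by
  set X : Fin n → Ω → ℝ := fun i ω => c i * (Set.Iic (0 : ℝ)).indicator 1 (ε i ω) with hX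
  have hgm : ∀ i, Measurable fun x : ℝ => c i * (Set.Iic (0 : ℝ)).indicator (1 : ℝ → ℝ) x :=
    fun i => (measurable_one.indicator measurableSet_Iic).const_mul _
  have hXm : ∀ i, Measurable (X i) := fun i => (hgm i).comp (hε i)
  have hmean : ∀ i, ∫ ω, X i ω ∂Pr = c i * τ := by
    intro i
    simp only [hX]
    rw [integral_const_mul, ← hq i]
    congr 1
    rw [← integral_indicator_one (measurableSet_le (hε i) measurable_const)]
    rfl
  have hsub : ∀ i, HasSubgaussianMGF (fun ω => X i ω - c i * τ) ((‖m‖₊ / 2) ^ 2) Pr := by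
    intro i
    have hci := abs_le.1 (hc i)
    have := hasSubgaussianMGF_of_mem_Icc (μ := Pr) (X := X i)
      -- A multiple of an indicator ranges over `[0, m]` or `[-m, 0]`, of length `m` and not `2 m`.
      (a := if 0 ≤ c i then 0 else -m) (b := (if 0 ≤ c i then 0 else -m) + m)
      (hXm i).aemeasurable (ae_of_all _ fun ω => by
        simp only [hX, Set.indicator, Set.mem_Icc, Pi.one_apply]
        split_ifs <;> constructor <;> linarith)
    rwa [hmean, add_sub_cancel_left] at this
  have hYind : iIndepFun (fun i ω => X i ω - c i * τ) Pr :=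
    hind.comp (fun i x => c i * (Set.Iic (0 : ℝ)).indicator 1 x - c i * τ)
      fun i => (hgm i).sub_const _
  have h := HasSubgaussianMGF.measure_sum_ge_le_of_iIndepFun hYind (s := Finset.univ)
    (c := fun _ => (‖m‖₊ / 2) ^ 2) (fun i _ => hsub i) ht
  simp only [hX, ← mul_sub] at h
  refine h.trans (le_of_eq (congrArg Real.exp ?_))
  have hnm : (‖m‖ : ℝ) = m := Real.norm_of_nonneg hm.le
  simp only [Finset.sum_const, Finset.card_univ, Fintype.card_fin, nsmul_eq_mul]
  push_cast
  rw [hnm]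
  rcases eq_or_ne (n : ℝ) 0 with hn | hn
  · simp [hn]
  · field_simp

end Tails

/-! ### Finite nets -/

/-- A grid of mesh `ζ / s` in orthonormal coordinates, with rounding errors added by the triangle
inequality. The crude cardinality is harmless because only its logarithm is used. -/
theorem exists_finset_net {E : Type*} [NormedAddCommGroup E] [InnerProductSpace ℝ E]
    [FiniteDimensional ℝ E] {s : ℕ} (hs : 0 < s) (hE : Module.finrank ℝ E ≤ s) {R ζ : ℝ}
    (hζ : 0 < ζ) :
    ∃ G : Finset E, (G.card : ℝ) ≤ (2 * (⌈R * s / ζ⌉₊ : ℝ) + 1) ^ s ∧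
      ∀ w : E, ‖w‖ ≤ R → ∃ g ∈ G, ‖g - w‖ ≤ ζ := by
  classical
  set q := Module.finrank ℝ E
  set b := stdOrthonormalBasis ℝ E
  set N : ℕ := ⌈R * s / ζ⌉₊ with hN
  have hs' : (0 : ℝ) < s := Nat.cast_pos.2 hs
  set η : ℝ := ζ / s with hη
  have hηpos : 0 < η := by positivity
  set F : (Fin q → ℤ) → E := fun k => ∑ i, ((k i : ℝ) * η) • b i with hF
  refine ⟨(Fintype.piFinset fun _ : Fin q => Finset.Icc (-(N : ℤ)) N).image F, ?_, ?_⟩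
  · have h1 : ((Fintype.piFinset fun _ : Fin q => Finset.Icc (-(N : ℤ)) N).image F).card
        ≤ (2 * N + 1) ^ s := by
      refine Finset.card_image_le.trans ?_
      rw [Fintype.card_piFinset]
      simp only [Int.card_Icc, Finset.prod_const, Finset.card_univ, Fintype.card_fin]
      have : ((N : ℤ) + 1 - -(N : ℤ)).toNat = 2 * N + 1 := by omega
      rw [this]
      exact Nat.pow_le_pow_right (by omega) hE
    exact_mod_cast h1
  · intro w hw
    set k : Fin q → ℤ := fun i => ⌊inner ℝ (b i) w / η⌋ with hk
    refine ⟨F k, Finset.mem_image_of_mem _ (Fintype.mem_piFinset.2 fun i => ?_), ?_⟩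
    · have hci : |inner ℝ (b i) w| ≤ R := by
        refine (abs_real_inner_le_norm _ _).trans ?_
        rw [b.orthonormal.1 i, one_mul]; exact hw
      have hNR : R / η ≤ N := by
        rw [hη, div_div_eq_mul_div]
        exact Nat.le_ceil _
      have h2 : |inner ℝ (b i) w / η| ≤ N := by
        rw [abs_div, abs_of_pos hηpos]
        exact (div_le_div_of_nonneg_right hci hηpos.le).trans hNR
      rw [abs_le] at h2
      rw [Finset.mem_Icc]
      constructor
      · rw [Int.le_floor]; push_cast; exact h2.1
      · have := (Int.floor_le (inner ℝ (b i) w / η)).trans h2.2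
        exact_mod_cast this
    · have e : F k - w = ∑ i, ((k i : ℝ) * η - inner ℝ (b i) w) • b i := by
        conv_lhs => rw [← b.sum_repr' w]
        rw [hF, ← Finset.sum_sub_distrib]
        exact Finset.sum_congr rfl fun i _ => (sub_smul _ _ _).symm
      rw [e]
      have hq : (q : ℝ) ≤ s := Nat.cast_le.2 hE
      calc _ ≤ ∑ i : Fin q, η := by
            refine (norm_sum_le _ _).trans (Finset.sum_le_sum fun i _ => ?_)
            rw [norm_smul, b.orthonormal.1 i, mul_one, Real.norm_eq_abs, abs_le]
            have h1 := Int.floor_le (inner ℝ (b i) w / η)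
            have h2 := Int.lt_floor_add_one (inner ℝ (b i) w / η)
            rw [le_div_iff₀ hηpos] at h1
            rw [div_lt_iff₀ hηpos] at h2
            constructor <;> simp only [hk] <;> linarith
        _ = q * η := by simp
        _ ≤ s * η := mul_le_mul_of_nonneg_right hq hηpos.le
        _ = ζ := by rw [hη]; field_simp

/-! ### Uniform control of the gradient -/

/-- The point of `[-u, u]` closest to `x`. -/
def clip (u x : ℝ) : ℝ := max (-u) (min u x)

theorem clip_mono (u : ℝ) : Monotone (clip u) := fun _ _ h =>
  max_le_max le_rfl (min_le_min le_rfl h)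

theorem clip_of_abs_le {u x : ℝ} (h : |x| ≤ u) : clip u x = x := by
  rw [abs_le] at h
  rw [clip, min_eq_right h.2, max_eq_right h.1]

theorem abs_clip_le {u : ℝ} (hu : 0 ≤ u) (x : ℝ) : |clip u x| ≤ u ∧ |clip u x| ≤ |x| := by
  unfold clip
  rcases max_cases (-u) (min u x) with ⟨e, h⟩ | ⟨e, h⟩ <;> rw [e] <;>
    rcases min_cases u x with ⟨e', h'⟩ | ⟨e', h'⟩ <;> try rw [e'] at h ⊢
  all_goals
    constructor <;> rcases abs_cases x with ⟨ex, hx⟩ | ⟨ex, hx⟩ <;>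
      first | (rw [abs_le]; constructor <;> linarith)

namespace QuantileModel

variable {τ : ℝ} (Q : QuantileModel τ)

/-- The indicators differ only between `0` and `h`. The set `S` may be the open or the closed
half-line, as the bracketing needs both. -/
theorem integral_abs_indicator_sub_le {u₀ fmin fmax : ℝ} (hfmax : 0 ≤ fmax)
    (hb : Q.DensityBounds u₀ fmin fmax) (i : Fin Q.n) {h : ℝ} (hh : |h| ≤ u₀) {S : Set ℝ}
    (hSm : MeasurableSet S) (hS1 : Set.Iio h ⊆ S) (hS2 : S ⊆ Set.Iic h) :
    ∫ ω, |S.indicator (1 : ℝ → ℝ) (Q.ε i ω) - (Set.Iic (0 : ℝ)).indicator 1 (Q.ε i ω)| ∂Q.Pr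
      ≤ fmax * |h| := by
  have hm : Measurable fun x : ℝ =>
      |S.indicator (1 : ℝ → ℝ) x - (Set.Iic (0 : ℝ)).indicator 1 x| :=
    ((measurable_one.indicator hSm).sub (measurable_one.indicator measurableSet_Iic)).abs
  rw [← integral_map (Q.measurable_ε i).aemeasurable hm.aestronglyMeasurable]
  have hpt : ∀ x : ℝ, |S.indicator (1 : ℝ → ℝ) x - (Set.Iic (0 : ℝ)).indicator 1 x|
      ≤ (Set.Icc (min 0 h) (max 0 h)).indicator 1 x := by
    intro x
    have h1 := @hS1 x
    have h2 := @hS2 x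
    rw [Set.mem_Iio] at h1
    rw [Set.mem_Iic] at h2
    simp only [Set.indicator, Set.mem_Iic, Set.mem_Icc, Pi.one_apply, min_le_iff, le_max_iff]
    split_ifs with ha hb' hc hc hb' hc hc <;> simp <;> grind
  have hI : ∫ x, (Set.Icc (min 0 h) (max 0 h)).indicator (1 : ℝ → ℝ) x ∂(Q.Pr.map (Q.ε i))
      = (Q.Pr.map (Q.ε i)).real (Set.Icc (min 0 h) (max 0 h)) :=
    integral_indicator_one measurableSet_Icc
  calc _ ≤ (Q.Pr.map (Q.ε i)).real (Set.Icc (min 0 h) (max 0 h)) := by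
        rw [← hI]
        exact integral_mono_of_nonneg (ae_of_all _ fun x => abs_nonneg _)
          ((integrable_const (1 : ℝ)).indicator measurableSet_Icc) (ae_of_all _ hpt)
    _ ≤ fmax * (max 0 h - min 0 h) := by
        refine measure_le_of_density_le hfmax min_le_max (Q.density i) fun u hu => (hb i u ?_).2
        rw [abs_le] at hh ⊢
        constructor
        · refine le_trans ?_ hu.1
          exact le_min (by linarith [hh.1, hh.2]) hh.1
        · exact hu.2.trans (max_le (by linarith [hh.1, hh.2]) hh.2)
    _ = fmax * |h| := by rw [max_sub_min_eq_abs', zero_sub, abs_neg]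

/-- For `w` within `ζ` of a net point `g`, monotonicity bounds `c i * σ i` by `c i` times an
indicator with threshold `g i ± ζ`, whatever `σ` does at zero residuals. This reduces the supremum
over `w` and `σ` to finitely many sums. -/
theorem exists_gradient_event {u₀ fmin fmax : ℝ} (hu₀ : 0 < u₀) (hfmax : 0 ≤ fmax)
    (hb : Q.DensityBounds u₀ fmin fmax) (hn : 0 < Q.n)
    (W : Submodule ℝ (EuclideanSpace ℝ (Fin Q.n))) {s : ℕ} (hs : 0 < s)
    (hW : Module.finrank ℝ W ≤ s) {R ζ m κ : ℝ} (hζ : 0 < ζ) (hm : 0 < m)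
    (hκ : 0 < κ) (hnum : s * Real.log (2 * (⌈R * s / ζ⌉₊ : ℝ) + 1)
      + 2 * (fmax * (√Q.n * (R + ζ) + Q.n * ζ)) ≤ (3 / 4 - 1 / 104) * (Q.n * κ / m))
    {c : Fin Q.n → ℝ} (hc : ∀ i, |c i| ≤ m) :
    ∃ N : Set Q.Ω, MeasurableSet N ∧
      Q.Pr.real N ≤ Real.exp (-(Q.n * κ / (104 * m)))
        + Real.exp (-(Q.n * κ ^ 2 / (32 * m ^ 2))) ∧
      ∀ ω ∉ N, ∀ w ∈ W, ‖w‖ ≤ R → (∀ i, |w i| ≤ u₀) → ∀ σ : Fin Q.n → ℝ,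
        (∀ i, 0 ≤ σ i ∧ σ i ≤ 1 ∧ (Q.ε i ω - w i < 0 → σ i = 1) ∧
          (0 < Q.ε i ω - w i → σ i = 0)) →
        ∑ i, (σ i - τ) * c i < Q.n * κ := by
  classical
  have hn' : (0 : ℝ) < Q.n := Nat.cast_pos.2 hn
  obtain ⟨G₀, hG₀card, hG₀⟩ := exists_finset_net (E := W) hs hW (R := R) hζ
  set G := G₀.filter fun g => ‖g‖ ≤ R + ζ with hG
  -- The shift follows the sign of `c i` so that the bracket is an upper bound. Clipping keeps the
  -- threshold where the density bound holds and preserves the comparison with `w i`, which lies in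
  -- `[-u₀, u₀]` already.
  set h : W → Fin Q.n → ℝ := fun g i => clip u₀
    (if 0 ≤ c i then (g : EuclideanSpace ℝ (Fin Q.n)) i + ζ
      else (g : EuclideanSpace ℝ (Fin Q.n)) i - ζ) with hh
  -- At equality the closed half-line dominates any `σ ≤ 1` and the open one is dominated by any `σ
  -- ≥ 0`.
  set S : W → Fin Q.n → Set ℝ := fun g i =>
    if 0 ≤ c i then Set.Iic (h g i) else Set.Iio (h g i) with hS
  have hSm : ∀ g i, MeasurableSet (S g i) := by
    intro g i
    simp only [hS]
    split_ifs
    exacts [measurableSet_Iic, measurableSet_Iio]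
  have hS1 : ∀ g i, Set.Iio (h g i) ⊆ S g i := by
    intro g i
    simp only [hS]
    split_ifs
    exacts [Set.Iio_subset_Iic_self, subset_rfl]
  have hS2 : ∀ g i, S g i ⊆ Set.Iic (h g i) := by
    intro g i
    simp only [hS]
    split_ifs
    exacts [subset_rfl, Set.Iio_subset_Iic_self]
  have hhabs : ∀ g i, |h g i| ≤ |(g : EuclideanSpace ℝ (Fin Q.n)) i| + ζ := by
    intro g i
    refine (abs_clip_le hu₀.le _).2.trans ?_
    split_ifs
    · exact (abs_add_le _ _).trans (by rw [abs_of_pos hζ])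
    · exact (abs_sub _ _).trans (by rw [abs_of_pos hζ])
  set ξ : W → Fin Q.n → ℝ → ℝ := fun g i x =>
    (S g i).indicator 1 x - (Set.Iic (0 : ℝ)).indicator 1 x with hξ
  -- The total allowance `n κ` is split into `3/4` for the increments and `1/8` for the centred sum.
  -- The first share also pays for net and drift and leaves the exponent `1/104`; the second gives
  -- Hoeffding's `1/32`.
  set B : W → Set Q.Ω := fun g => {ω | 3 / 4 * (Q.n * κ) ≤ ∑ i, c i * ξ g i (Q.ε i ω)} with hB
  set B₀ : Set Q.Ω := {ω | Q.n * κ / 8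
    ≤ ∑ i, c i * ((Set.Iic (0 : ℝ)).indicator 1 (Q.ε i ω) - τ)} with hB₀
  have hξm : ∀ g i, Measurable (ξ g i) := fun g i =>
    (measurable_one.indicator (hSm g i)).sub (measurable_one.indicator measurableSet_Iic)
  have hBm : ∀ g, MeasurableSet (B g) := fun g => measurableSet_le measurable_const
    (Finset.measurable_sum _ fun i _ => ((hξm g i).comp (Q.measurable_ε i)).const_mul _)
  have hB₀m : MeasurableSet B₀ := measurableSet_le measurable_const
    (Finset.measurable_sum _ fun i _ => ((((measurable_one (α := ℝ)).indicator
      measurableSet_Iic).comp (Q.measurable_ε i)).sub_const τ).const_mul _)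
  have hB₀p : Q.Pr.real B₀ ≤ Real.exp (-(Q.n * κ ^ 2 / (32 * m ^ 2))) := by
    refine (measureReal_sum_indicator_sub_ge_le Q.measurable_ε Q.indep Q.quantile hm hc
      (by positivity)).trans (le_of_eq (congrArg Real.exp ?_))
    field_simp
    ring
  have hBp : ∀ g ∈ G, Q.Pr.real (B g)
      ≤ Real.exp (-(3 / 4 * (Q.n * κ) / m) + 2 * (fmax * (√Q.n * (R + ζ) + Q.n * ζ))) := by
    intro g hg
    refine (measureReal_sum_mul_ge_le Q.measurable_ε Q.indep hm hc (hξm g) (fun i x => ?_)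
      (v := fun i => fmax * (|(g : EuclideanSpace ℝ (Fin Q.n)) i| + ζ)) (fun i => ?_) _).trans ?_
    · simp only [hξ, Set.indicator, Pi.one_apply]
      split_ifs <;> simp
    · exact (Q.integral_abs_indicator_sub_le hfmax hb i (abs_clip_le hu₀.le _).1 (hSm g i)
        (hS1 g i) (hS2 g i)).trans (mul_le_mul_of_nonneg_left (hhabs g i) hfmax)
    · refine Real.exp_le_exp.2 (add_le_add le_rfl (mul_le_mul_of_nonneg_left ?_ (by norm_num)))
      rw [← Finset.mul_sum, Finset.sum_add_distrib]
      refine mul_le_mul_of_nonneg_left (add_le_add ?_ (by simp)) hfmax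
      exact (sum_abs_coord_le _).trans (mul_le_mul_of_nonneg_left (Finset.mem_filter.1 hg).2
        (Real.sqrt_nonneg _))
  refine ⟨B₀ ∪ ⋃ g ∈ G, B g, hB₀m.union (Finset.measurableSet_biUnion _ fun g _ => hBm g), ?_, ?_⟩
  · have hunion : Q.Pr.real (⋃ g ∈ G, B g) ≤ Real.exp (-(Q.n * κ / (104 * m))) := by
      refine (measureReal_biUnion_finset_le _ _).trans ((Finset.sum_le_sum hBp).trans ?_)
      rw [Finset.sum_const, nsmul_eq_mul]
      have hcard : (G.card : ℝ) ≤ Real.exp (s * Real.log (2 * (⌈R * s / ζ⌉₊ : ℝ) + 1)) := by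
        rw [mul_comm, Real.exp_mul, Real.exp_log (by positivity), Real.rpow_natCast]
        exact (Nat.cast_le.2 (Finset.card_filter_le _ _)).trans hG₀card
      refine (mul_le_mul_of_nonneg_right hcard (Real.exp_pos _).le).trans ?_
      rw [← Real.exp_add]
      refine Real.exp_le_exp.2 ?_
      have e1 : 3 / 4 * (Q.n * κ) / m = 3 / 4 * (Q.n * κ / m) := by ring
      have e2 : Q.n * κ / (104 * m) = 1 / 104 * (Q.n * κ / m) := by field_simp
      rw [e1, e2]
      linarith
    rw [add_comm (Real.exp _)]
    exact (measureReal_union_le _ _).trans (add_le_add hB₀p hunion)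
  · intro ω hω w hw hwR hwu σ hσ
    rw [Set.mem_union, not_or] at hω
    obtain ⟨g, hg, hgw⟩ := hG₀ ⟨w, hw⟩ hwR
    have hgG : g ∈ G := by
      refine Finset.mem_filter.2 ⟨hg, ?_⟩
      have h1 : ‖(⟨w, hw⟩ : W)‖ ≤ R := hwR
      have h2 := norm_add_le (g - ⟨w, hw⟩) ⟨w, hw⟩
      rw [sub_add_cancel] at h2
      linarith
    have hωg : ω ∉ B g := fun hcon => hω.2 (Set.mem_iUnion₂.2 ⟨g, hgG, hcon⟩)
    have hcoord : ∀ i, |(g : EuclideanSpace ℝ (Fin Q.n)) i - w i| ≤ ζ := fun i =>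
      (abs_coord_le_norm ((g : EuclideanSpace ℝ (Fin Q.n)) - w) i).trans hgw
    have hterm : ∀ i, (σ i - τ) * c i ≤ c i * ξ g i (Q.ε i ω)
        + c i * ((Set.Iic (0 : ℝ)).indicator 1 (Q.ε i ω) - τ) := by
      intro i
      obtain ⟨h0, h1, hneg, hpos⟩ := hσ i
      have hci := abs_le.1 (hcoord i)
      have hwi := clip_of_abs_le (hwu i)
      have key : c i * σ i ≤ c i * (S g i).indicator 1 (Q.ε i ω) := by
        by_cases hcs : 0 ≤ c i
        · have hle : w i ≤ h g i := by
            rw [← hwi]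
            simp only [hh, if_pos hcs]
            exact clip_mono u₀ (by linarith)
          refine mul_le_mul_of_nonneg_left ?_ hcs
          simp only [hS, if_pos hcs, Set.indicator, Set.mem_Iic, Pi.one_apply]
          split_ifs with hx
          · exact h1
          · exact (hpos (by linarith)).le
        · have hle : h g i ≤ w i := by
            conv_rhs => rw [← hwi]
            simp only [hh, if_neg hcs]
            exact clip_mono u₀ (by linarith)
          refine mul_le_mul_of_nonpos_left ?_ (not_le.1 hcs).le
          simp only [hS, if_neg hcs, Set.indicator, Set.mem_Iio, Pi.one_apply]
          split_ifs with hx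
          · exact (hneg (by linarith)).ge
          · exact h0
      simp only [hξ]
      linarith
    have hsum := Finset.sum_le_sum fun i (_ : i ∈ Finset.univ) => hterm i
    rw [Finset.sum_add_distrib] at hsum
    have hb1 : ∑ i, c i * ξ g i (Q.ε i ω) < 3 / 4 * (Q.n * κ) := not_le.1 hωg
    have hb2 : ∑ i, c i * ((Set.Iic (0 : ℝ)).indicator 1 (Q.ε i ω) - τ) < Q.n * κ / 8 :=
      not_le.1 hω.1
    have : 0 < Q.n * κ := by positivity
    linarith

end QuantileModel

/-! ### Folded concave penalties and the LLA algorithm -/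

namespace IsFoldedConcave

variable {a₁ a₂ a lam : ℝ} {P : ℝ → ℝ}

theorem le_penaltySlope (h : IsFoldedConcave a₁ a₂ a lam P) {t : ℝ} (ht : 0 ≤ t)
    (ht' : t ≤ a₂ * lam) : a₁ * lam ≤ penaltySlope P t := by
  unfold penaltySlope
  split_ifs with h0
  · obtain ⟨L, hL, hlim⟩ := h.slope_zero
    rwa [hlim.limUnder_eq]
  · exact h.slope_near t (lt_of_le_of_ne ht (Ne.symm h0)) ht'

theorem penaltySlope_eq_zero (h : IsFoldedConcave a₁ a₂ a lam P) {t : ℝ} (ht : 0 < t)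
    (ht' : a * lam ≤ t) : penaltySlope P t = 0 := by
  rw [penaltySlope, if_neg ht.ne']
  exact h.slope_far t ht ht'

end IsFoldedConcave

section LLA

variable {p : ℕ} {A : Finset (Fin p)} {ell : (Fin p → ℝ) → ℝ} {target g : Fin p → ℝ} {κ : ℝ}

/-- Off the support the weight dominates the slope: `g j * β j + w j * |β j| ≥ (κ - |g j|) * |β j|`.
The slack on the left gives both minimality of the target and, when strict, the support of every
other minimizer. -/
theorem weighted_le_of_subgradient
    (hsub : ∀ β, ell target + ∑ j ∈ Aᶜ, g j * β j ≤ ell β)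
    (hz : ∀ j ∉ A, target j = 0) {w : Fin p → ℝ} (hw0 : ∀ j ∈ A, w j = 0)
    (hwκ : ∀ j ∉ A, κ ≤ w j) (β : Fin p → ℝ) :
    (ell target + ∑ j, w j * |target j|) + ∑ j ∈ Aᶜ, (κ - |g j|) * |β j|
      ≤ ell β + ∑ j, w j * |β j| := by
  have h1 : ∑ j, w j * |target j| = 0 := by
    refine Finset.sum_eq_zero fun j _ => ?_
    by_cases hj : j ∈ A
    · rw [hw0 j hj, zero_mul]
    · rw [hz j hj, abs_zero, mul_zero]
  have h2 : ∑ j, w j * |β j| = ∑ j ∈ Aᶜ, w j * |β j| := by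
    rw [← Finset.sum_add_sum_compl A, Finset.sum_eq_zero, zero_add]
    intro j hj
    rw [hw0 j hj, zero_mul]
  have h3 : ∑ j ∈ Aᶜ, (κ - |g j|) * |β j| ≤ ∑ j ∈ Aᶜ, g j * β j + ∑ j ∈ Aᶜ, w j * |β j| := by
    rw [← Finset.sum_add_distrib]
    refine Finset.sum_le_sum fun j hj => ?_
    have h4 := neg_abs_le (g j * β j)
    rw [abs_mul] at h4
    have := mul_le_mul_of_nonneg_right (hwκ j (Finset.mem_compl.1 hj)) (abs_nonneg (β j))
    linarith
  rw [h1, h2]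
  linarith [hsub β]

theorem eq_of_isMinOn_weighted
    (hsub : ∀ β, ell target + ∑ j ∈ Aᶜ, g j * β j ≤ ell β) (hg : ∀ j ∉ A, |g j| < κ)
    (huniq : ∀ β, (∀ j ∉ A, β j = 0) → ell β ≤ ell target → β = target)
    (hz : ∀ j ∉ A, target j = 0) {w : Fin p → ℝ} (hw0 : ∀ j ∈ A, w j = 0)
    (hwκ : ∀ j ∉ A, κ ≤ w j) {β : Fin p → ℝ}
    (hβ : IsMinOn (fun β => ell β + ∑ j, w j * |β j|) Set.univ β) : β = target := by
  have h1 := weighted_le_of_subgradient hsub hz hw0 hwκ β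
  have h2 : ell β + ∑ j, w j * |β j| ≤ ell target + ∑ j, w j * |target j| :=
    hβ (Set.mem_univ target)
  have hnn : ∀ j ∈ Aᶜ, 0 ≤ (κ - |g j|) * |β j| := fun j hj =>
    mul_nonneg (sub_nonneg.2 (hg j (Finset.mem_compl.1 hj)).le) (abs_nonneg _)
  have hs : ∑ j ∈ Aᶜ, (κ - |g j|) * |β j| = 0 :=
    le_antisymm (by linarith) (Finset.sum_nonneg hnn)
  have hβ0 : ∀ j ∉ A, β j = 0 := by
    intro j hj
    have := (Finset.sum_eq_zero_iff_of_nonneg hnn).1 hs j (Finset.mem_compl.2 hj)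
    rcases mul_eq_zero.1 this with h | h
    · exact absurd h (sub_pos.2 (hg j hj)).ne'
    · exact abs_eq_zero.1 h
  have hpen : ∀ b : Fin p → ℝ, (∀ j ∉ A, b j = 0) → ∑ j, w j * |b j| = 0 := by
    intro b hb
    refine Finset.sum_eq_zero fun j _ => ?_
    by_cases hj : j ∈ A
    · rw [hw0 j hj, zero_mul]
    · rw [hb j hj, abs_zero, mul_zero]
  rw [hpen β hβ0, hpen target hz] at h2
  exact huniq β hβ0 (by linarith)

theorem llaConvergesInTwo_of_subgradient
    (hsub : ∀ β, ell target + ∑ j ∈ Aᶜ, g j * β j ≤ ell β) (hg : ∀ j ∉ A, |g j| < κ)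
    (huniq : ∀ β, (∀ j ∉ A, β j = 0) → ell β ≤ ell target → β = target)
    (hz : ∀ j ∉ A, target j = 0) {P : ℝ → ℝ} {b₀ : Fin p → ℝ}
    (h00 : ∀ j ∈ A, penaltySlope P |b₀ j| = 0) (h0κ : ∀ j ∉ A, κ ≤ penaltySlope P |b₀ j|)
    (h10 : ∀ j ∈ A, penaltySlope P |target j| = 0)
    (h1κ : ∀ j ∉ A, κ ≤ penaltySlope P |target j|) :
    LLAConvergesInTwo P ell b₀ target := by
  have hmin : ∀ w : Fin p → ℝ, (∀ j ∈ A, w j = 0) → (∀ j ∉ A, κ ≤ w j) →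
      IsMinOn (fun β => ell β + ∑ j, w j * |β j|) Set.univ target := by
    intro w hw0 hwκ β _
    have h1 := weighted_le_of_subgradient hsub hz hw0 hwκ β
    have hnn : 0 ≤ ∑ j ∈ Aᶜ, (κ - |g j|) * |β j| := Finset.sum_nonneg fun j hj =>
      mul_nonneg (sub_nonneg.2 (hg j (Finset.mem_compl.1 hj)).le) (abs_nonneg _)
    change ell target + ∑ j, w j * |target j| ≤ ell β + ∑ j, w j * |β j|
    linarith
  -- The run that jumps to the target and stays there witnesses existence.
  refine ⟨⟨fun m => if m = 0 then b₀ else target, rfl, fun m => ?_⟩, fun b hb m hm => ?_⟩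
  · simp only [Nat.add_eq_zero_iff, one_ne_zero, and_false, if_false]
    rcases eq_or_ne m 0 with rfl | hm
    · simpa using hmin _ h00 h0κ
    · simpa [hm] using hmin _ h10 h1κ
  · induction m, hm using Nat.le_induction with
    | base =>
      have := hb.2 0
      rw [hb.1] at this
      exact eq_of_isMinOn_weighted hsub hg huniq hz h00 h0κ this
    | succ m _ ih =>
      have := hb.2 m
      rw [ih] at this
      exact eq_of_isMinOn_weighted hsub hg huniq hz h10 h1κ this

end LLA

/-! ### The active part of the design -/

theorem Matrix.IsHermitian.iInf_eigenvalues_mul_le {ι : Type*} [Fintype ι] [DecidableEq ι]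
    {G : Matrix ι ι ℝ} (hG : G.IsHermitian) (v : ι → ℝ) :
    (⨅ k, hG.eigenvalues k) * ∑ k, v k ^ 2 ≤ v ⬝ᵥ G.mulVec v := by
  set b := hG.eigenvectorBasis
  set x : EuclideanSpace ℝ ι := WithLp.toLp 2 v
  set y : EuclideanSpace ℝ ι := WithLp.toLp 2 (G.mulVec v)
  have h1 : v ⬝ᵥ G.mulVec v = inner ℝ x y := by
    rw [PiLp.inner_apply]
    simp [dotProduct, x, y, mul_comm]
  have h2 : ∀ k, inner ℝ (b k) y = hG.eigenvalues k * inner ℝ (b k) x := by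
    intro k
    have e1 : inner ℝ (b k) y = (b k).ofLp ⬝ᵥ G.mulVec v := by
      rw [PiLp.inner_apply]
      simp [dotProduct, y, mul_comm]
    have e2 : inner ℝ (b k) x = (b k).ofLp ⬝ᵥ v := by
      rw [PiLp.inner_apply]
      simp [dotProduct, x, mul_comm]
    have e3 : G.transpose = G := by
      have := hG
      rwa [Matrix.IsHermitian, Matrix.conjTranspose_eq_transpose_of_trivial] at this
    rw [e1, e2, Matrix.dotProduct_mulVec, ← Matrix.mulVec_transpose, e3,
      hG.mulVec_eigenvectorBasis, smul_dotProduct, smul_eq_mul]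
  have h3 : ∑ k, v k ^ 2 = ∑ k, ‖inner ℝ (b k) x‖ ^ 2 := by
    rw [b.sum_sq_norm_inner_right, EuclideanSpace.real_norm_sq_eq]
  rw [h1, h3, ← b.sum_inner_mul_inner, Finset.mul_sum]
  refine Finset.sum_le_sum fun k _ => ?_
  rw [h2, real_inner_comm, Real.norm_eq_abs, sq_abs]
  have := ciInf_le (Set.finite_range hG.eigenvalues).bddBelow k
  nlinarith [mul_le_mul_of_nonneg_right this (sq_nonneg (inner ℝ (b k) x))]

namespace QuantileModel

variable {τ : ℝ} (Q : QuantileModel τ)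

/-- The range of the active part of the design. -/
def designSpan : Submodule ℝ (EuclideanSpace ℝ (Fin Q.n)) :=
  LinearMap.range ((WithLp.linearEquiv 2 ℝ (Fin Q.n → ℝ)).symm.toLinearMap ∘ₗ Q.XA.mulVecLin)

theorem finrank_designSpan_le : Module.finrank ℝ Q.designSpan ≤ Q.s := by
  refine (LinearMap.finrank_range_le _).trans ?_
  simp [s]

/-- The vector of fitted values `X β`. -/
def fitted (β : Fin Q.p → ℝ) : EuclideanSpace ℝ (Fin Q.n) :=
  WithLp.toLp 2 fun i => ∑ j, Q.X i j * β j

theorem fitted_apply (β : Fin Q.p → ℝ) (i : Fin Q.n) : Q.fitted β i = ∑ j, Q.X i j * β j := rfl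

theorem fitted_apply_of_support {β : Fin Q.p → ℝ} (hβ : ∀ j ∉ Q.A, β j = 0) (i : Fin Q.n) :
    Q.fitted β i = ∑ j ∈ Q.A, Q.X i j * β j := by
  rw [fitted_apply]
  refine (Finset.sum_subset (Finset.subset_univ _) fun j _ hj => ?_).symm
  rw [hβ j hj, mul_zero]

theorem fitted_mem_designSpan {β : Fin Q.p → ℝ} (hβ : ∀ j ∉ Q.A, β j = 0) :
    Q.fitted β ∈ Q.designSpan := by
  refine ⟨fun j => β j, ?_⟩
  ext i
  rw [fitted_apply_of_support Q hβ, ← Finset.sum_coe_sort]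
  rfl

theorem exists_of_mem_designSpan {w : EuclideanSpace ℝ (Fin Q.n)} (hw : w ∈ Q.designSpan) :
    ∃ β : Fin Q.p → ℝ, (∀ j ∉ Q.A, β j = 0) ∧ Q.fitted β = w := by
  classical
  obtain ⟨c, rfl⟩ := hw
  have h0 : ∀ j ∉ Q.A, (fun j => if h : j ∈ Q.A then c ⟨j, h⟩ else 0) j = 0 :=
    fun j hj => dif_neg hj
  refine ⟨fun j => if h : j ∈ Q.A then c ⟨j, h⟩ else 0, h0, ?_⟩
  ext i
  rw [fitted_apply_of_support Q h0, ← Finset.sum_coe_sort]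
  have : ∀ j : Q.A, (if h : (j : Fin Q.p) ∈ Q.A then c ⟨j, h⟩ else 0) = c j :=
    fun j => dif_pos j.2
  simp only [this]
  rfl

theorem fitted_add (β γ : Fin Q.p → ℝ) : Q.fitted (β + γ) = Q.fitted β + Q.fitted γ := by
  ext i
  simp [fitted_apply, mul_add, Finset.sum_add_distrib]

theorem loss_eq (ω : Q.Ω) (β : Fin Q.p → ℝ) :
    Q.loss ω β = (1 / (Q.n : ℝ)) * ∑ i, checkLoss τ (Q.ε i ω - Q.fitted (β - Q.βstar) i) := by
  rw [loss]
  congr 1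
  refine Finset.sum_congr rfl fun i _ => ?_
  congr 1
  rw [y, fitted_apply]
  simp only [Pi.sub_apply, mul_sub, Finset.sum_sub_distrib]
  ring

theorem βstar_eq_zero {j : Fin Q.p} (hj : j ∉ Q.A) : Q.βstar j = 0 := by
  simpa [A] using hj

theorem minSignal_le {j : Fin Q.p} (hj : j ∈ Q.A) : Q.minSignal ≤ |Q.βstar j| :=
  ciInf_le (f := fun j : Q.A => |Q.βstar j|) (Set.finite_range _).bddBelow ⟨j, hj⟩

theorem s_le_p : Q.s ≤ Q.p := by
  have := Finset.card_le_univ Q.A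
  simpa [s] using this

theorem sum_sq_le_MA_mul (hA : Q.A.Nonempty) (i : Fin Q.n) :
    ∑ j ∈ Q.A, Q.X i j ^ 2 ≤ Q.MA * Q.s := by
  have hs : (0 : ℝ) < Q.s := Nat.cast_pos.2 (Finset.card_pos.2 hA)
  have := le_ciSup (f := fun i : Fin Q.n => (1 / (Q.s : ℝ)) * ∑ j ∈ Q.A, Q.X i j ^ 2)
    (Set.finite_range _).bddAbove i
  rw [one_div_mul_eq_div, div_le_iff₀ hs] at this
  exact this

theorem abs_le_mAc (i : Fin Q.n) {j : Fin Q.p} (hj : j ∉ Q.A) : |Q.X i j| ≤ Q.mAc :=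
  le_ciSup (f := fun ij : Fin Q.n × {j : Fin Q.p // j ∉ Q.A} => |Q.X ij.1 ij.2|)
    (Set.finite_range _).bddAbove (i, ⟨j, hj⟩)

theorem mAc_nonneg : 0 ≤ Q.mAc := Real.iSup_nonneg fun _ => abs_nonneg _

theorem lamMin_mul_le {β : Fin Q.p → ℝ} (hβ : ∀ j ∉ Q.A, β j = 0) :
    Q.n * Q.lamMin * ∑ j ∈ Q.A, β j ^ 2 ≤ ‖Q.fitted β‖ ^ 2 := by
  rcases Nat.eq_zero_or_pos Q.n with hn | hn
  · have : (Q.n : ℝ) = 0 := by rw [hn, Nat.cast_zero]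
    rw [this, zero_mul, zero_mul]
    positivity
  have hn' : (0 : ℝ) < Q.n := Nat.cast_pos.2 hn
  have h := Q.gram_isHermitian.iInf_eigenvalues_mul_le fun j : Q.A => β j
  rw [Finset.sum_coe_sort Q.A fun j => β j ^ 2] at h
  have e : (fun j : Q.A => β j) ⬝ᵥ Q.gram.mulVec (fun j : Q.A => β j)
      = 1 / Q.n * ‖Q.fitted β‖ ^ 2 := by
    rw [gram, Matrix.smul_mulVec, dotProduct_smul, smul_eq_mul, ← Matrix.mulVec_mulVec,
      Matrix.dotProduct_mulVec, Matrix.vecMul_transpose, EuclideanSpace.real_norm_sq_eq]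
    congr 1
    refine Finset.sum_congr rfl fun i _ => ?_
    rw [← sq, fitted_apply_of_support Q hβ, ← Finset.sum_coe_sort]
    rfl
  rw [e] at h
  have h2 := mul_le_mul_of_nonneg_left h hn'.le
  rw [← mul_assoc, ← mul_assoc, mul_one_div_cancel hn'.ne', one_mul] at h2
  exact h2

/-- The smallest eigenvalue is at most every diagonal entry of the Gram matrix, and the average of
these entries is at most `M_A`. -/
theorem lamMin_le_MA (hA : Q.A.Nonempty) (hn : 0 < Q.n) : Q.lamMin ≤ Q.MA := by
  classical
  have hs : (0 : ℝ) < Q.s := Nat.cast_pos.2 (Finset.card_pos.2 hA)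
  have hn' : (0 : ℝ) < Q.n := Nat.cast_pos.2 hn
  have h1 : ∀ j ∈ Q.A, Q.n * Q.lamMin ≤ ∑ i, Q.X i j ^ 2 := by
    intro j hj
    have hz : ∀ k ∉ Q.A, (Pi.single j (1 : ℝ) : Fin Q.p → ℝ) k = 0 := fun k hk =>
      Pi.single_eq_of_ne (fun h : k = j => hk (h ▸ hj)) _
    have h := Q.lamMin_mul_le hz
    have e1 : ∑ k ∈ Q.A, (Pi.single j (1 : ℝ) : Fin Q.p → ℝ) k ^ 2 = 1 := by
      rw [Finset.sum_eq_single_of_mem j hj]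
      · simp
      · intro k _ hk; simp [hk]
    rw [e1, mul_one, EuclideanSpace.real_norm_sq_eq] at h
    refine h.trans (le_of_eq (Finset.sum_congr rfl fun i _ => ?_))
    rw [fitted_apply]
    simp [Pi.single_apply]
  have h2 := Finset.sum_le_sum h1
  rw [Finset.sum_const, nsmul_eq_mul, Finset.sum_comm] at h2
  have h3 := h2.trans (Finset.sum_le_sum fun i (_ : i ∈ Finset.univ) => Q.sum_sq_le_MA_mul hA i)
  rw [Finset.sum_const, nsmul_eq_mul, Finset.card_univ, Fintype.card_fin] at h3
  change (Q.s : ℝ) * _ ≤ _ at h3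
  have h4 : Q.s * Q.n * Q.lamMin ≤ Q.s * Q.n * Q.MA := by linarith
  exact le_of_mul_le_mul_left h4 (by positivity)

theorem lamMin_nonneg : 0 ≤ Q.lamMin := by
  refine Real.iInf_nonneg fun k => ?_
  have hps : Q.gram.PosSemidef := by
    refine Matrix.PosSemidef.smul ?_ (by positivity)
    have := Matrix.posSemidef_conjTranspose_mul_self Q.XA
    rwa [Matrix.conjTranspose_eq_transpose_of_trivial] at this
  exact hps.eigenvalues_nonneg k

theorem abs_fitted_le {β : Fin Q.p → ℝ} (hA : Q.A.Nonempty) (hβ : ∀ j ∉ Q.A, β j = 0)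
    {d : ℝ} (hd : 0 ≤ d) (hβd : ∑ j ∈ Q.A, β j ^ 2 ≤ d ^ 2) (i : Fin Q.n) :
    |Q.fitted β i| ≤ √(Q.MA * Q.s) * d := by
  rw [fitted_apply_of_support Q hβ]
  have h := Finset.sum_mul_sq_le_sq_mul_sq Q.A (fun j => Q.X i j) β
  have hM := Q.sum_sq_le_MA_mul hA i
  have hM0 : 0 ≤ Q.MA * Q.s := (Finset.sum_nonneg fun j _ => sq_nonneg _).trans hM
  refine abs_le_of_sq_le_sq ?_ (by positivity)
  rw [mul_pow, Real.sq_sqrt hM0]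
  exact h.trans (mul_le_mul hM hβd (Finset.sum_nonneg fun j _ => sq_nonneg _) hM0)

theorem fitted_smul (t : ℝ) (β : Fin Q.p → ℝ) : Q.fitted (t • β) = t • Q.fitted β := by
  ext i
  simp only [fitted_apply, PiLp.smul_apply, Pi.smul_apply, smul_eq_mul, Finset.mul_sum]
  exact Finset.sum_congr rfl fun j _ => by ring

/-! ### The oracle estimator -/

variable {Q}

theorem IsOracle.sub_eq_zero {ω : Q.Ω} {b : Fin Q.p → ℝ} (hb : Q.IsOracle ω b) :
    ∀ j ∉ Q.A, (b - Q.βstar) j = 0 := fun j hj => by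
  rw [Pi.sub_apply, hb.1 j hj, Q.βstar_eq_zero hj, sub_zero]

theorem IsOracle.sum_checkLoss_le {ω : Q.Ω} {b : Fin Q.p → ℝ} (hb : Q.IsOracle ω b)
    (hn : 0 < Q.n) {w : EuclideanSpace ℝ (Fin Q.n)} (hw : w ∈ Q.designSpan) :
    ∑ i, checkLoss τ (Q.ε i ω - Q.fitted (b - Q.βstar) i)
      ≤ ∑ i, checkLoss τ (Q.ε i ω - Q.fitted (b - Q.βstar) i - w i) := by
  obtain ⟨β, hβ, rfl⟩ := Q.exists_of_mem_designSpan hw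
  have h := hb.2 (b + β) fun j hj => by rw [Pi.add_apply, hb.1 j hj, hβ j hj, add_zero]
  rw [loss_eq, loss_eq, show b + β - Q.βstar = (b - Q.βstar) + β by abel, fitted_add] at h
  have hn' : (0 : ℝ) < 1 / Q.n := by positivity
  have h2 := le_of_mul_le_mul_left h hn'
  simpa only [PiLp.add_apply, sub_sub] using h2

theorem IsOracle.sum_checkLoss_sub_nonpos {ω : Q.Ω} {b : Fin Q.p → ℝ} (hb : Q.IsOracle ω b)
    (hn : 0 < Q.n) :
    ∑ i, (checkLoss τ (Q.ε i ω - Q.fitted (b - Q.βstar) i) - checkLoss τ (Q.ε i ω)) ≤ 0 := by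
  have h := hb.sum_checkLoss_le hn
    (Q.designSpan.neg_mem (Q.fitted_mem_designSpan hb.sub_eq_zero))
  rw [Finset.sum_sub_distrib]
  simpa using h

/-- If no vector of the sphere of radius `R` in the design span beats the truth, the oracle is
within `d` of the truth, where `R² = n λ_min d²`. -/
theorem IsOracle.sum_sq_lt {ω : Q.Ω} {b : Fin Q.p → ℝ} (hb : Q.IsOracle ω b)
    (hA : Q.A.Nonempty) (hn : 0 < Q.n) {u₀ d R : ℝ} (hd : 0 < d)
    (hRd : R ^ 2 = Q.n * Q.lamMin * d ^ 2) (hdu : √(Q.MA * Q.s) * d ≤ u₀)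
    (hloc : ∀ w ∈ Q.designSpan, (∀ i, |w i| ≤ u₀) →
      ∑ i, (checkLoss τ (Q.ε i ω - w i) - checkLoss τ (Q.ε i ω)) ≤ 0 → ‖w‖ < R) :
    ∑ j ∈ Q.A, (b - Q.βstar) j ^ 2 < d ^ 2 := by
  by_contra hcon
  rw [not_lt] at hcon
  set Δ := b - Q.βstar
  set r := √(∑ j ∈ Q.A, Δ j ^ 2) with hr
  have hsum0 : 0 ≤ ∑ j ∈ Q.A, Δ j ^ 2 := Finset.sum_nonneg fun j _ => sq_nonneg _
  have hr2 : r ^ 2 = ∑ j ∈ Q.A, Δ j ^ 2 := Real.sq_sqrt hsum0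
  have hdr : d ≤ r := Real.le_sqrt_of_sq_le hcon
  have hrpos : 0 < r := hd.trans_le hdr
  -- The error is shrunk to length exactly `d`, where the fitted values are guaranteed to stay
  -- within `u₀` and localization applies.
  set t := d / r with ht
  have ht0 : 0 ≤ t := by positivity
  have ht1 : t ≤ 1 := (div_le_one hrpos).2 hdr
  have hsupp : ∀ j ∉ Q.A, (t • Δ) j = 0 := fun j hj => by
    exact (congrArg (t • ·) (hb.sub_eq_zero j hj)).trans (smul_zero t)
  have hsq : ∑ j ∈ Q.A, (t • Δ) j ^ 2 = d ^ 2 := by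
    simp only [Pi.smul_apply, smul_eq_mul, mul_pow, ← Finset.mul_sum]
    rw [← hr2, ht, ← mul_pow, div_mul_cancel₀ _ hrpos.ne']
  have h1 := hloc (Q.fitted (t • Δ)) (Q.fitted_mem_designSpan hsupp)
    (fun i => (Q.abs_fitted_le hA hsupp hd.le hsq.le i).trans hdu) (by
      have h2 : ∑ i, (checkLoss τ (Q.ε i ω - Q.fitted (t • Δ) i) - checkLoss τ (Q.ε i ω))
          ≤ t * ∑ i, (checkLoss τ (Q.ε i ω - Q.fitted Δ i) - checkLoss τ (Q.ε i ω)) := by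
        rw [Finset.mul_sum, fitted_smul]
        exact Finset.sum_le_sum fun i _ => checkLoss_sub_mul_le ht0 ht1 _ _
      exact h2.trans (mul_nonpos_of_nonneg_of_nonpos ht0 (hb.sum_checkLoss_sub_nonpos hn)))
  have h2 := Q.lamMin_mul_le hsupp
  rw [hsq, ← hRd] at h2
  exact absurd h1 (not_lt.2 (le_of_sq_le_sq h2 (norm_nonneg _)))

/-- The loss lies above an affine function touching it at the oracle, whose slope vanishes in the
active coordinates. -/
theorem IsOracle.exists_subgradient {ω : Q.Ω} {b : Fin Q.p → ℝ} (hb : Q.IsOracle ω b)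
    (hn : 0 < Q.n) :
    ∃ σ : Fin Q.n → ℝ,
      (∀ i, 0 ≤ σ i ∧ σ i ≤ 1 ∧ (Q.ε i ω - Q.fitted (b - Q.βstar) i < 0 → σ i = 1) ∧
          (0 < Q.ε i ω - Q.fitted (b - Q.βstar) i → σ i = 0)) ∧
      ∀ β, Q.loss ω b + ∑ j ∈ Q.Aᶜ, (1 / (Q.n : ℝ) * ∑ i, (σ i - τ) * Q.X i j) * β j
        ≤ Q.loss ω β := by
  classical
  obtain ⟨σ, hσ, hσW⟩ := exists_subgradient_of_isMin Q.designSpan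
    (fun i => Q.ε i ω - Q.fitted (b - Q.βstar) i) fun w hw => hb.sum_checkLoss_le hn hw
  refine ⟨σ, hσ, fun β => ?_⟩
  have hsplit : β - Q.βstar = (b - Q.βstar) + (β - b) := by abel
  have h1 : ∑ i, (checkLoss τ (Q.ε i ω - Q.fitted (b - Q.βstar) i)
      + (σ i - τ) * Q.fitted (β - b) i)
      ≤ ∑ i, checkLoss τ (Q.ε i ω - Q.fitted (β - Q.βstar) i) := by
    refine Finset.sum_le_sum fun i _ => ?_
    rw [hsplit, fitted_add, PiLp.add_apply, ← sub_sub]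
    exact checkLoss_subgradient τ (hσ i).1 (hσ i).2.1 (hσ i).2.2.1 (hσ i).2.2.2 _
  -- The active part `γ` is annihilated by `σ - τ`, so only the inactive coordinates contribute to
  -- the slope.
  set γ : Fin Q.p → ℝ := fun j => if j ∈ Q.A then (β - b) j else 0 with hγ
  set δ : Fin Q.p → ℝ := fun j => if j ∈ Q.A then 0 else β j with hδ
  have hγδ : β - b = γ + δ := by
    ext j
    simp only [hγ, hδ, Pi.add_apply, Pi.sub_apply]
    split_ifs with hj
    · rw [add_zero]
    · rw [hb.1 j hj]; ring
  have h2 := hσW _ (Q.fitted_mem_designSpan (β := γ) fun j hj => if_neg hj)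
  have h3 : ∀ i, Q.fitted δ i = ∑ j ∈ Q.Aᶜ, Q.X i j * β j := by
    intro i
    rw [fitted_apply, ← Finset.sum_add_sum_compl Q.A, Finset.sum_eq_zero, zero_add]
    · refine Finset.sum_congr rfl fun j hj => ?_
      simp only [hδ, if_neg (Finset.mem_compl.1 hj)]
    · intro j hj
      simp only [hδ, if_pos hj, mul_zero]
  have h4 : ∑ i, (σ i - τ) * Q.fitted (β - b) i
      = ∑ j ∈ Q.Aᶜ, (∑ i, (σ i - τ) * Q.X i j) * β j := by
    rw [hγδ, fitted_add]
    simp only [PiLp.add_apply, mul_add, Finset.sum_add_distrib]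
    rw [h2, zero_add]
    simp only [h3, Finset.mul_sum, Finset.sum_mul]
    rw [Finset.sum_comm]
    exact Finset.sum_congr rfl fun j _ => Finset.sum_congr rfl fun i _ => by ring
  rw [Finset.sum_add_distrib, h4] at h1
  have h5 := mul_le_mul_of_nonneg_left h1 (by positivity : 0 ≤ 1 / (Q.n : ℝ))
  rw [loss_eq, loss_eq]
  refine le_trans (le_of_eq ?_) h5
  rw [mul_add, Finset.mul_sum (Q.Aᶜ)]
  congr 1
  exact Finset.sum_congr rfl fun j _ => by ring

end QuantileModel

/-! ### Choice of constants and assembly of the good event -/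

namespace QuantileModel

variable {τ : ℝ} (Q : QuantileModel τ)

theorem expNegDiv_of_pos (x : ℝ) {y : ℝ} (hy : 0 < y) : expNegDiv x y = Real.exp (-(x / y)) :=
  if_neg hy.ne'

theorem expNegDiv_nonneg (x y : ℝ) : 0 ≤ expNegDiv x y := by
  unfold expNegDiv
  split_ifs
  · exact le_rfl
  · exact (Real.exp_pos _).le

theorem s_pos (hA : Q.A.Nonempty) : 0 < Q.s := Finset.card_pos.2 hA

theorem card_compl_A [DecidableEq (Fin Q.p)] : ((Q.Aᶜ.card : ℕ) : ℝ) = (Q.p : ℝ) - Q.s := by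
  rw [Finset.card_compl, Nat.cast_sub (Finset.card_le_univ _), Fintype.card_fin]
  rfl

/-- The radius, in fitted values, of the ball in which the oracle lies with probability at least
`1 - 2 n ^ (-1 / 2)`. -/
def oracleRadius (fmin : ℝ) : ℝ := 4 * √(Q.s * Real.log Q.n) / fmin

/-- Every cost is at most a constant times `√n * s * √(log n)`, which `hgrowth` bounds by `q * (n λ
/ m)`. The assumption `a₁ λ ≤ m` yields `s √(log n) ≤ √n`; hence `R s √n` is polynomial in `n` and
the net has logarithmic size `O(s log n)`. The total is at most half of `a₁ n λ / m`, less than the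
allowance `3/4 - 1/104`. -/
theorem net_budget {fmin fmax a₁ lam m q : ℝ} (hfmin : 0 < fmin) (hfmax : 0 ≤ fmax)
    (ha₁ : 0 < a₁) (hlam : 0 < lam) (hA : Q.A.Nonempty) (hn : 3 ≤ Q.n) (hm : a₁ * lam ≤ m)
    (hq0 : 0 < q)
    (hq : 2 * (Real.log (8 / fmin + 3) + 3 + 2 * fmax * (4 / fmin + 2)) * q ≤ a₁)
    (hgrowth : m * Q.s * √(Real.log Q.n) ≤ q * (√Q.n * lam)) :
    Q.s * Real.log (2 * (⌈Q.oracleRadius fmin * Q.s / (1 / √Q.n)⌉₊ : ℝ) + 1)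
      + 2 * (fmax * (√Q.n * (Q.oracleRadius fmin + 1 / √Q.n) + Q.n * (1 / √Q.n)))
      ≤ (3 / 4 - 1 / 104) * (Q.n * (a₁ * lam) / m) := by
  have hn3 : (3 : ℝ) ≤ Q.n := by exact_mod_cast hn
  have hnpos : (0 : ℝ) < Q.n := by linarith
  have hm0 : 0 < m := (mul_pos ha₁ hlam).trans_le hm
  have hs1 : (1 : ℝ) ≤ Q.s := by exact_mod_cast Q.s_pos hA
  set n := (Q.n : ℝ)
  set s := (Q.s : ℝ)
  set l := Real.log n with hl
  have hl1 : 1 ≤ l := by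
    rw [hl, Real.le_log_iff_exp_le hnpos]
    linarith [Real.exp_one_lt_d9]
  have hln : l ≤ n := (Real.log_le_sub_one_of_pos hnpos).trans (by linarith)
  set r := √n with hr
  have hr2 : r * r = n := Real.mul_self_sqrt hnpos.le
  have hr1 : 1 ≤ r := Real.one_le_sqrt.2 (by linarith)
  have hrn : r ≤ n := hr2 ▸ le_mul_of_one_le_left (by linarith) hr1
  set k := √l with hk
  have hk2 : k * k = l := Real.mul_self_sqrt (by linarith)
  have hk1 : 1 ≤ k := Real.one_le_sqrt.2 hl1
  have hkr : k ≤ r := Real.sqrt_le_sqrt hln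
  have hK0 : 0 ≤ Real.log (8 / fmin + 3) := Real.log_nonneg (by
    have : 0 < 8 / fmin := by positivity
    linarith)
  set K := Real.log (8 / fmin + 3) with hK
  have hqa : q ≤ a₁ := by
    have : 0 ≤ 2 * fmax * (4 / fmin + 2) := by positivity
    refine le_trans (le_mul_of_one_le_left hq0.le ?_) hq
    linarith
  have hg : s * k ≤ q * (r * lam / m) := by
    rw [mul_div_assoc', le_div_iff₀ hm0]; linarith
  have hlm : lam / m ≤ 1 / a₁ := by
    rw [div_le_div_iff₀ hm0 ha₁]; linarith
  have hsr : s * k ≤ r := by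
    refine hg.trans ?_
    calc q * (r * lam / m) = q * (lam / m) * r := by ring
      _ ≤ a₁ * (1 / a₁) * r := by
          refine mul_le_mul_of_nonneg_right ?_ (by linarith)
          exact mul_le_mul hqa hlm (by positivity) ha₁.le
      _ = r := by rw [mul_one_div_cancel ha₁.ne', one_mul]
  have hsn : s ≤ n := ((le_mul_of_one_le_right (by linarith) hk1).trans hsr).trans hrn
  set Y := n * lam / m with hY
  have hg2 : r * (s * k) ≤ q * Y := by
    calc r * (s * k) ≤ r * (q * (r * lam / m)) := mul_le_mul_of_nonneg_left hg (by linarith)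
      _ = q * Y := by rw [hY, ← hr2]; ring
  set R := Q.oracleRadius fmin with hR
  have hsl : √(s * l) ≤ s * k := by
    rw [Real.sqrt_mul (by linarith)]
    refine mul_le_mul_of_nonneg_right ?_ (by linarith)
    exact Real.sqrt_le_iff.2 ⟨by linarith, le_self_pow₀ hs1 two_ne_zero⟩
  have hRle : R ≤ 4 / fmin * (s * k) := by
    rw [hR, oracleRadius, mul_div_right_comm]
    exact mul_le_mul_of_nonneg_left hsl (by positivity)
  have hR0 : 0 ≤ R := by rw [hR, oracleRadius]; positivity
  have hcard : Real.log (2 * (⌈R * s / (1 / r)⌉₊ : ℝ) + 1) ≤ (K + 3) * l := by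
    have hx0 : 0 ≤ R * s / (1 / r) := by positivity
    have h1 := (Nat.ceil_lt_add_one hx0).le
    have h2 : R * s / (1 / r) ≤ 4 / fmin * n ^ 3 := by
      rw [div_div_eq_mul_div, div_one]
      calc R * s * r ≤ (4 / fmin * n) * n * n := by
            refine mul_le_mul (mul_le_mul (hRle.trans ?_) hsn (by linarith) (by positivity)) hrn
              (by linarith) (by positivity)
            exact mul_le_mul_of_nonneg_left (hsr.trans hrn) (by positivity)
        _ = 4 / fmin * n ^ 3 := by ring
    have h3 : (1 : ℝ) ≤ n ^ 3 := one_le_pow₀ (by linarith)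
    have h4 : 2 * (⌈R * s / (1 / r)⌉₊ : ℝ) + 1 ≤ (8 / fmin + 3) * n ^ 3 := by
      have : (8 / fmin + 3) * n ^ 3 = 2 * (4 / fmin * n ^ 3) + 3 * n ^ 3 := by ring
      linarith
    calc _ ≤ Real.log ((8 / fmin + 3) * n ^ 3) := Real.log_le_log (by positivity) h4
      _ = K + 3 * l := by
          rw [Real.log_mul (by positivity) (by positivity), Real.log_pow]; push_cast; ring
      _ ≤ (K + 3) * l := by
          rw [add_mul]; linarith [le_mul_of_one_le_right hK0 hl1]
  have hpart1 : s * Real.log (2 * (⌈R * s / (1 / r)⌉₊ : ℝ) + 1) ≤ (K + 3) * (q * Y) := by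
    calc _ ≤ s * ((K + 3) * l) := mul_le_mul_of_nonneg_left hcard (by linarith)
      _ = (K + 3) * (k * (s * k)) := by rw [← hk2]; ring
      _ ≤ (K + 3) * (r * (s * k)) := by
          refine mul_le_mul_of_nonneg_left ?_ (by linarith)
          exact mul_le_mul_of_nonneg_right hkr (by positivity)
      _ ≤ (K + 3) * (q * Y) := mul_le_mul_of_nonneg_left hg2 (by linarith)
  have hsk1 : 1 ≤ s * k := one_le_mul_of_one_le_of_one_le hs1 hk1
  have hpart2 : r * (R + 1 / r) + n * (1 / r) ≤ (4 / fmin + 2) * (q * Y) := by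
    have e1 : r * (R + 1 / r) = r * R + 1 := by field_simp
    have e2 : n * (1 / r) = r := by rw [← hr2]; field_simp
    have h1 : r * R ≤ 4 / fmin * (r * (s * k)) := by
      calc r * R ≤ r * (4 / fmin * (s * k)) := mul_le_mul_of_nonneg_left hRle (by linarith)
        _ = _ := by ring
    have h2 : r ≤ r * (s * k) := le_mul_of_one_le_right (by linarith) hsk1
    rw [e1, e2]
    calc r * R + 1 + r ≤ (4 / fmin + 2) * (r * (s * k)) := by linarith
      _ ≤ _ := mul_le_mul_of_nonneg_left hg2 (by positivity)
  have hY0 : 0 ≤ Y := by positivity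
  calc _ ≤ (K + 3) * (q * Y) + 2 * (fmax * ((4 / fmin + 2) * (q * Y))) :=
        add_le_add hpart1 (mul_le_mul_of_nonneg_left
          (mul_le_mul_of_nonneg_left hpart2 hfmax) (by norm_num))
    _ = (2 * (K + 3 + 2 * fmax * (4 / fmin + 2)) * q) * Y / 2 := by ring
    _ ≤ a₁ * Y / 2 := by
        refine div_le_div_of_nonneg_right (mul_le_mul_of_nonneg_right hq hY0) (by norm_num)
    _ ≤ (3 / 4 - 1 / 104) * (a₁ * Y) := by linarith [mul_nonneg ha₁.le hY0]
    _ = _ := by rw [hY]; ring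

theorem exists_uniform_gradient_event (hτ : τ ∈ Set.Ioo (0 : ℝ) 1)
    {u₀ fmin fmax a₁ lam q : ℝ} (hu₀ : 0 < u₀)
    (hfmin : 0 < fmin) (hfmax : 0 ≤ fmax) (ha₁ : 0 < a₁) (hlam : 0 < lam)
    (hb : Q.DensityBounds u₀ fmin fmax) (hA : Q.A.Nonempty) (hn : 3 ≤ Q.n) (hq0 : 0 < q)
    (hq : 2 * (Real.log (8 / fmin + 3) + 3 + 2 * fmax * (4 / fmin + 2)) * q ≤ a₁)
    (hgrowth : Q.mAc * Q.s * √(Real.log Q.n) ≤ q * (√Q.n * lam)) :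
    ∃ N : Set Q.Ω, MeasurableSet N ∧
      Q.Pr.real N ≤ 2 * ((Q.p : ℝ) - Q.s) * expNegDiv (a₁ * Q.n * lam) (104 * Q.mAc)
        + 2 * ((Q.p : ℝ) - Q.s) * expNegDiv (a₁ ^ 2 * Q.n * lam ^ 2) (32 * Q.mAc ^ 2) ∧
      ∀ ω ∉ N, ∀ w ∈ Q.designSpan, ‖w‖ ≤ Q.oracleRadius fmin → (∀ i, |w i| ≤ u₀) →
        ∀ σ : Fin Q.n → ℝ, (∀ i, 0 ≤ σ i ∧ σ i ≤ 1 ∧ (Q.ε i ω - w i < 0 → σ i = 1) ∧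
          (0 < Q.ε i ω - w i → σ i = 0)) →
        ∀ j ∉ Q.A, |∑ i, (σ i - τ) * Q.X i j| < Q.n * (a₁ * lam) := by
  classical
  have hnpos : (0 : ℝ) < Q.n := Nat.cast_pos.2 (by omega)
  have hps : 0 ≤ (Q.p : ℝ) - Q.s := sub_nonneg.2 (Nat.cast_le.2 Q.s_le_p)
  -- When `m_{A^c} < a₁ λ`, which includes `m_{A^c} = 0`, the gradient bound is deterministic since
  -- `|σ i - τ| ≤ 1`.
  rcases lt_or_ge Q.mAc (a₁ * lam) with hsmall | hm
  · refine ⟨∅, MeasurableSet.empty, ?_, ?_⟩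
    · rw [measureReal_empty]
      have := expNegDiv_nonneg (a₁ * Q.n * lam) (104 * Q.mAc)
      have := expNegDiv_nonneg (a₁ ^ 2 * Q.n * lam ^ 2) (32 * Q.mAc ^ 2)
      positivity
    · intro ω _ w _ _ _ σ hσ j hj
      calc |∑ i, (σ i - τ) * Q.X i j| ≤ ∑ _i : Fin Q.n, Q.mAc := by
            refine (Finset.abs_sum_le_sum_abs _ _).trans (Finset.sum_le_sum fun i _ => ?_)
            rw [abs_mul]
            have h1 : |σ i - τ| ≤ 1 := by
              obtain ⟨h0, h1, -, -⟩ := hσ i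
              rw [abs_le]; constructor <;> linarith [hτ.1, hτ.2]
            calc |σ i - τ| * |Q.X i j| ≤ 1 * Q.mAc :=
                  mul_le_mul h1 (Q.abs_le_mAc i hj) (abs_nonneg _) zero_le_one
              _ = Q.mAc := one_mul _
        _ = Q.n * Q.mAc := by simp
        _ < Q.n * (a₁ * lam) := mul_lt_mul_of_pos_left hsmall hnpos
  have hm0 : 0 < Q.mAc := (mul_pos ha₁ hlam).trans_le hm
  have hnum := Q.net_budget hfmin hfmax ha₁ hlam hA hn hm hq0 hq hgrowth
  have hev : ∀ (c : Fin Q.n → ℝ), (∀ i, |c i| ≤ Q.mAc) → _ := fun c hc =>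
    Q.exists_gradient_event hu₀ hfmax hb (by omega) Q.designSpan (Q.s_pos hA)
      Q.finrank_designSpan_le (one_div_pos.2 (Real.sqrt_pos.2 hnpos)) hm0 (mul_pos ha₁ hlam) hnum
      (c := c) hc
  have hev1 : ∀ j : {j // j ∉ Q.A}, _ := fun j =>
    hev (fun i => Q.X i j) fun i => Q.abs_le_mAc i j.2
  have hev2 : ∀ j : {j // j ∉ Q.A}, _ := fun j =>
    hev (fun i => -Q.X i j) fun i => by rw [abs_neg]; exact Q.abs_le_mAc i j.2
  choose N₁ hN₁m hN₁p hN₁ using hev1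
  choose N₂ hN₂m hN₂p hN₂ using hev2
  refine ⟨⋃ j, (N₁ j ∪ N₂ j), MeasurableSet.iUnion fun j => (hN₁m j).union (hN₂m j), ?_, ?_⟩
  · have hcard : ((Fintype.card {j // j ∉ Q.A} : ℕ) : ℝ) = (Q.p : ℝ) - Q.s := by
      rw [← Q.card_compl_A, Fintype.card_subtype]
      congr 2
      ext j; simp
    rw [expNegDiv_of_pos _ (by positivity), expNegDiv_of_pos _ (by positivity)]
    set e₁ := Real.exp (-(a₁ * Q.n * lam / (104 * Q.mAc)))
    set e₂ := Real.exp (-(a₁ ^ 2 * Q.n * lam ^ 2 / (32 * Q.mAc ^ 2)))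
    have hE : Real.exp (-(Q.n * (a₁ * lam) / (104 * Q.mAc)))
        + Real.exp (-(Q.n * (a₁ * lam) ^ 2 / (32 * Q.mAc ^ 2))) = e₁ + e₂ := by
      simp only [e₁, e₂]
      congr 3 <;> ring
    calc _ ≤ ∑ j : {j // j ∉ Q.A}, Q.Pr.real (N₁ j ∪ N₂ j) := by
          have := measureReal_biUnion_finset_le (μ := Q.Pr) Finset.univ fun j => N₁ j ∪ N₂ j
          simpa using this
      _ ≤ ∑ _j : {j // j ∉ Q.A}, ((e₁ + e₂) + (e₁ + e₂)) := by
          refine Finset.sum_le_sum fun j _ => (measureReal_union_le _ _).trans ?_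
          exact add_le_add ((hN₁p j).trans hE.le) ((hN₂p j).trans hE.le)
      _ = _ := by
          rw [Finset.sum_const, nsmul_eq_mul, Finset.card_univ, hcard]; ring
  · intro ω hω w hw hwR hwu σ hσ j hj
    rw [Set.mem_iUnion, not_exists] at hω
    have hωj := hω ⟨j, hj⟩
    rw [Set.mem_union, not_or] at hωj
    have h1 := hN₁ ⟨j, hj⟩ ω hωj.1 w hw hwR hwu σ hσ
    have h2 := hN₂ ⟨j, hj⟩ ω hωj.2 w hw hwR hwu σ hσ
    simp only [mul_neg, Finset.sum_neg_distrib] at h2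
    rw [abs_lt]
    constructor <;> linarith

theorem exists_llaConvergesInTwo_event (hτ : τ ∈ Set.Ioo (0 : ℝ) 1)
    {a₁ a₂ a u₀ fmin fmax lam q : ℝ} (ha₁ : 0 < a₁) (ha₂ : 0 < a₂) (ha : a₂ < a) (hu₀ : 0 < u₀)
    (hfmin : 0 < fmin) (hfmax : 0 ≤ fmax) (hlam : 0 < lam) {P : ℝ → ℝ}
    (hP : IsFoldedConcave a₁ a₂ a lam P)
    (hb : Q.DensityBounds u₀ fmin fmax) (hA : Q.A.Nonempty) (hn : 3 ≤ Q.n)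
    (hsig : (a + 1) * lam < Q.minSignal)
    (hdu : √(Q.MA * Q.s) * (Q.minSignal - a * lam) ≤ u₀) (hq0 : 0 < q)
    (hq : 2 * (Real.log (8 / fmin + 3) + 3 + 2 * fmax * (4 / fmin + 2)) * q ≤ a₁)
    (hgrowth : Q.mAc * Q.s * √(Real.log Q.n) ≤ q * (√Q.n * lam))
    (init oracle : Q.Ω → Fin Q.p → ℝ)
    (horacle : ∀ᵐ ω ∂Q.Pr, Q.IsUniqueOracle ω (oracle ω)) :
    ∃ E : Set Q.Ω, MeasurableSet E ∧
      (∀ ω ∈ E, LLAConvergesInTwo P (Q.loss ω) (init ω) (oracle ω)) ∧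
      1 - Q.δ₀ a₂ lam init - Q.δ₁ a₁ 2 lam - Q.δ₂ a fmin lam ≤ Q.Pr.real E := by
  classical
  have hnpos : (0 : ℝ) < Q.n := Nat.cast_pos.2 (by omega)
  have hspos : (0 : ℝ) < Q.s := Nat.cast_pos.2 (Q.s_pos hA)
  have hps : 0 ≤ (Q.p : ℝ) - Q.s := sub_nonneg.2 (Nat.cast_le.2 Q.s_le_p)
  have hδ₀ : 0 ≤ Q.δ₀ a₂ lam init := measureReal_nonneg
  have hδ₁ : 0 ≤ Q.δ₁ a₁ 2 lam := by
    have := expNegDiv_nonneg (a₁ * Q.n * lam) (104 * Q.mAc)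
    have := expNegDiv_nonneg (a₁ ^ 2 * Q.n * lam ^ 2) (32 * Q.mAc ^ 2)
    unfold δ₁
    positivity
  -- For a singular Gram matrix `δ₂ = 4`, so the probability bound is negative and the empty event
  -- suffices.
  rcases Q.lamMin_nonneg.eq_or_lt with hlm | hlm
  · refine ⟨∅, MeasurableSet.empty, fun ω h => h.elim, ?_⟩
    have : Q.δ₂ a fmin lam = 4 := by
      unfold δ₂
      rw [← hlm]
      simp
    rw [measureReal_empty, this]
    linarith
  set d := Q.minSignal - a * lam with hd
  have hdpos : 0 < d := by rw [hd]; linarith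
  have hMA : 0 < Q.MA := hlm.trans_le (Q.lamMin_le_MA hA (by omega))
  set R₁ := √(Q.n * Q.lamMin) * d with hR₁
  have hR₁pos : 0 < R₁ := by positivity
  have hR₁sq : R₁ ^ 2 = Q.n * Q.lamMin * d ^ 2 := by
    rw [hR₁, mul_pow, Real.sq_sqrt (by positivity)]
  have hlog : 0 < Real.log Q.n := Real.log_pos (by exact_mod_cast (by omega : 1 < Q.n))
  have hR₂pos : 0 < Q.oracleRadius fmin := by unfold oracleRadius; positivity
  have hR₂sq : Q.oracleRadius fmin ^ 2 = 16 * (Q.s * Real.log Q.n) / fmin ^ 2 := by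
    rw [oracleRadius, div_pow, mul_pow, Real.sq_sqrt (by positivity)]; norm_num
  obtain ⟨N₁, hN₁m, hN₁p, hN₁⟩ := Q.exists_localization_event hτ hfmin hb Q.designSpan
    (Q.s_pos hA) Q.finrank_designSpan_le hR₁pos
  obtain ⟨N₂, hN₂m, hN₂p, hN₂⟩ := Q.exists_localization_event hτ hfmin hb Q.designSpan
    (Q.s_pos hA) Q.finrank_designSpan_le hR₂pos
  obtain ⟨N₃, hN₃m, hN₃p, hN₃⟩ := Q.exists_uniform_gradient_event hτ hu₀ hfmin hfmax ha₁ hlam hb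
    hA hn hq0 hq hgrowth
  -- Neither estimator is assumed measurable, so these bad sets are replaced by measurable hulls of
  -- the same measure.
  set I : Set Q.Ω := {ω | min 1 a₂ * lam < ‖init ω - Q.βstar‖} with hI
  set U : Set Q.Ω := {ω | ¬ Q.IsUniqueOracle ω (oracle ω)} with hU
  have hU0 : Q.Pr.real (toMeasurable Q.Pr U) = 0 := by
    rw [measureReal_def, measure_toMeasurable]
    have : Q.Pr U = 0 := horacle
    rw [this, ENNReal.toReal_zero]
  have hI0 : Q.Pr.real (toMeasurable Q.Pr I) = Q.δ₀ a₂ lam init := by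
    rw [measureReal_def, measure_toMeasurable]; rfl
  have hp1 : Q.Pr.real N₁ ≤ Q.δ₂ a fmin lam := by
    refine hN₁p.trans ?_
    unfold δ₂
    refine mul_le_mul (by norm_num) (Real.exp_le_exp.2 (neg_le_neg ?_)) (Real.exp_pos _).le
      (by norm_num)
    rw [hR₁sq]
    -- Localization gives an exponent linear in `λ_min`; `λ_min ≤ M_A` and `32 ≤ 72` weaken it to
    -- the stated one.
    have h1 : Q.lamMin ^ 2 * fmin ^ 2 / (72 * Q.MA) ≤ fmin ^ 2 * Q.lamMin / 32 := by
      rw [div_le_div_iff₀ (by positivity) (by norm_num)]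
      have h2 := Q.lamMin_le_MA hA (by omega)
      have h3 : 0 ≤ fmin ^ 2 * Q.lamMin := by positivity
      nlinarith [mul_le_mul_of_nonneg_left h2 h3]
    calc Q.lamMin ^ 2 * fmin ^ 2 / (72 * Q.MA) * (Q.n / Q.s) * d ^ 2
        ≤ fmin ^ 2 * Q.lamMin / 32 * (Q.n / Q.s) * d ^ 2 := by gcongr
      _ = fmin ^ 2 * (Q.n * Q.lamMin * d ^ 2) / (32 * Q.s) := by field_simp
  have hp2 : Q.Pr.real N₂ ≤ 4 * (Q.n : ℝ) ^ (-(1 / 2) : ℝ) := by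
    refine hN₂p.trans ?_
    rw [hR₂sq, Real.rpow_def_of_pos hnpos]
    have : -(fmin ^ 2 * (16 * (Q.s * Real.log Q.n) / fmin ^ 2) / (32 * Q.s))
        = Real.log Q.n * (-(1 / 2)) := by
      field_simp
      norm_num
    rw [this]
    linarith [Real.exp_pos (Real.log Q.n * (-(1 / 2)))]
  set B := toMeasurable Q.Pr I ∪ toMeasurable Q.Pr U ∪ N₁ ∪ N₂ ∪ N₃ with hB
  have hBm : MeasurableSet B := ((((measurableSet_toMeasurable _ _).union
    (measurableSet_toMeasurable _ _)).union hN₁m).union hN₂m).union hN₃m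
  refine ⟨Bᶜ, hBm.compl, ?_, ?_⟩
  · intro ω hω
    simp only [hB, Set.mem_compl_iff, Set.mem_union, not_or] at hω
    obtain ⟨⟨⟨⟨hωI, hωU⟩, hω1⟩, hω2⟩, hω3⟩ := hω
    have hinit : ‖init ω - Q.βstar‖ ≤ min 1 a₂ * lam :=
      not_lt.1 fun h => hωI (subset_toMeasurable _ _ h)
    have huo : Q.IsUniqueOracle ω (oracle ω) :=
      not_not.1 fun h => hωU (subset_toMeasurable _ _ h)
    set b := oracle ω
    have hor := huo.1
    have hn0 : 0 < Q.n := by omega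
    have hsq := hor.sum_sq_lt hA hn0 hdpos hR₁sq hdu (hN₁ ω hω1)
    have hwu : ∀ i, |Q.fitted (b - Q.βstar) i| ≤ u₀ := fun i =>
      (Q.abs_fitted_le hA hor.sub_eq_zero hdpos.le hsq.le i).trans hdu
    have hwW := Q.fitted_mem_designSpan hor.sub_eq_zero
    -- The second localization needs fitted errors within `u₀`, which the first one has just
    -- provided.
    have hwR := hN₂ ω hω2 _ hwW hwu (hor.sum_checkLoss_sub_nonpos hn0)
    obtain ⟨σ, hσ, hsub⟩ := hor.exists_subgradient hn0
    have hg := hN₃ ω hω3 _ hwW hwR.le hwu σ hσ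
    have hmin1 : min 1 a₂ * lam ≤ lam := by
      have := mul_le_mul_of_nonneg_right (min_le_left 1 a₂) hlam.le
      linarith
    have hmin2 : min 1 a₂ * lam ≤ a₂ * lam :=
      mul_le_mul_of_nonneg_right (min_le_right 1 a₂) hlam.le
    have halam : 0 < a * lam := mul_pos (ha₂.trans ha) hlam
    have hcoord : ∀ j, |init ω j - Q.βstar j| ≤ min 1 a₂ * lam := fun j =>
      (norm_le_pi_norm (init ω - Q.βstar) j).trans hinit
    refine llaConvergesInTwo_of_subgradient (A := Q.A) (κ := a₁ * lam) hsub (fun j hj => ?_)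
      (fun β hβ hle => huo.2 β ⟨hβ, fun γ hγ => hle.trans (hor.2 γ hγ)⟩) hor.1
      (fun j hj => ?_) (fun j hj => ?_) (fun j hj => ?_) (fun j hj => ?_)
    · rw [abs_mul, abs_of_pos (by positivity : 0 < 1 / (Q.n : ℝ)), one_div_mul_eq_div,
        div_lt_iff₀ hnpos, mul_comm (a₁ * lam)]
      exact hg j hj
    · have h1 := Q.minSignal_le hj
      have h2 := abs_sub_abs_le_abs_sub (Q.βstar j) (init ω j)
      rw [abs_sub_comm] at h2
      have h3 := hcoord j
      have h4 : a * lam < |init ω j| := by linarith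
      exact hP.penaltySlope_eq_zero (halam.trans h4) h4.le
    · have h3 := hcoord j
      rw [Q.βstar_eq_zero hj, sub_zero] at h3
      exact hP.le_penaltySlope (abs_nonneg _) (h3.trans hmin2)
    · have h1 := Q.minSignal_le hj
      have h2 := abs_sub_abs_le_abs_sub (Q.βstar j) (b j)
      rw [abs_sub_comm] at h2
      have h3 : |b j - Q.βstar j| < d := by
        refine abs_lt_of_sq_lt_sq ?_ hdpos.le
        refine lt_of_le_of_lt ?_ hsq
        exact Finset.single_le_sum (f := fun j => (b - Q.βstar) j ^ 2)
          (fun k _ => sq_nonneg _) hj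
      have h4 : a * lam < |b j| := by linarith
      exact hP.penaltySlope_eq_zero (halam.trans h4) h4.le
    · rw [hor.1 j hj, abs_zero]
      exact hP.le_penaltySlope le_rfl (by positivity)
  · rw [probReal_compl_eq_one_sub hBm]
    have h1 := measureReal_union_le (μ := Q.Pr)
      (toMeasurable Q.Pr I ∪ toMeasurable Q.Pr U ∪ N₁ ∪ N₂) N₃
    have h2 := measureReal_union_le (μ := Q.Pr)
      (toMeasurable Q.Pr I ∪ toMeasurable Q.Pr U ∪ N₁) N₂
    have h3 := measureReal_union_le (μ := Q.Pr) (toMeasurable Q.Pr I ∪ toMeasurable Q.Pr U) N₁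
    have h4 := measureReal_union_le (μ := Q.Pr) (toMeasurable Q.Pr I) (toMeasurable Q.Pr U)
    have h5 : Q.δ₁ a₁ 2 lam = 4 * (Q.n : ℝ) ^ (-(1 / 2) : ℝ)
      + 2 * ((Q.p : ℝ) - Q.s) * expNegDiv (a₁ * Q.n * lam) (104 * Q.mAc)
      + 2 * ((Q.p : ℝ) - Q.s) * expNegDiv (a₁ ^ 2 * Q.n * lam ^ 2) (32 * Q.mAc ^ 2) := rfl
    linarith

end QuantileModel

end

theorem theorem7
    -- the constants of the problem
    (τ : ℝ) (hτ : τ ∈ Set.Ioo (0 : ℝ) 1)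
    (a₁ a₂ a : ℝ) (ha₁ : 0 < a₁) (ha₂ : 0 < a₂) (ha : a₂ < a)
    (u₀ fmin fmax : ℝ) (hu₀ : 0 < u₀) (hfmin : 0 < fmin) (hf : fmin ≤ fmax) :
    ∃ C₁ : ℝ, 0 < C₁ ∧
      -- the family of penalties
      ∀ P : ℝ → ℝ → ℝ, (∀ l, 0 < l → IsFoldedConcave a₁ a₂ a l (P l)) →
      -- a sequence of models whose sample sizes tend to infinity, with tuning parameters
      ∀ (Q : ℕ → QuantileModel τ) (lam : ℕ → ℝ),
      Tendsto (fun k => (Q k).n) atTop atTop →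
      (∀ k, 0 < lam k) →
      (∀ k, (Q k).A.Nonempty) →
      (∀ k, (Q k).DensityBounds u₀ fmin fmax) →
      -- minimal signal strength
      (∀ k, (a + 1) * lam k < (Q k).minSignal) →
      -- growth conditions
      (fun k => 1 / ((Q k).n : ℝ)) =o[atTop] lam →
      (fun k => Real.log (Q k).p) =o[atTop] (fun k => (Q k).n * lam k ^ 2) →
      (∀ k, √((Q k).MA * (Q k).s) * ((Q k).minSignal - a * lam k) ≤ u₀) →
      (fun k => (Q k).mAc * (Q k).MA * (Q k).s) =o[atTop]
        (fun k => √((Q k).n : ℝ) * lam k / √(Real.log (Q k).n)) →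
      -- the active part of the design does not degenerate to zero
      (∃ c : ℝ, 0 < c ∧ ∀ k, c ≤ (Q k).MA) →
      -- the initial estimators, and the (almost surely unique) oracle estimators
      ∀ (init oracle : ∀ k, (Q k).Ω → Fin (Q k).p → ℝ),
      (∀ k, ∀ᵐ ω ∂(Q k).Pr, (Q k).IsUniqueOracle ω (oracle k ω)) →
      ∀ᶠ k in atTop, ∃ E : Set (Q k).Ω, MeasurableSet E ∧
        (∀ ω ∈ E, LLAConvergesInTwo (P (lam k)) ((Q k).loss ω) (init k ω) (oracle k ω)) ∧
        1 - (Q k).δ₀ a₂ (lam k) (init k) - (Q k).δ₁ a₁ C₁ (lam k) - (Q k).δ₂ a fmin (lam k)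
          ≤ (Q k).Pr.real E := by

  have hfmax : 0 < fmax := hfmin.trans_le hf
  have hK : 0 < 2 * (Real.log (8 / fmin + 3) + 3 + 2 * fmax * (4 / fmin + 2)) := by
    have : 0 ≤ Real.log (8 / fmin + 3) := Real.log_nonneg (by
      have : 0 < 8 / fmin := by positivity
      linarith)
    positivity
  refine ⟨2, by norm_num, ?_⟩
  intro P hP Q lam hn hlam hA hb hsig _ _ hdu hgrowth ⟨c, hc, hcMA⟩ init oracle horacle
  set q := a₁ / (2 * (Real.log (8 / fmin + 3) + 3 + 2 * fmax * (4 / fmin + 2)))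
  have hq0 : 0 < q := div_pos ha₁ hK
  -- Since `e < 3`, this makes `log n ≥ 1`. The factor `c` in the little-o constant is cancelled at
  -- the end by `c ≤ M_A`.
  filter_upwards [hn.eventually_ge_atTop 3, hgrowth.def (mul_pos hc hq0)] with k hk3 hkg
  refine (Q k).exists_llaConvergesInTwo_event hτ ha₁ ha₂ ha hu₀ hfmin hfmax.le (hlam k)
    (hP _ (hlam k)) (hb k) (hA k) hk3 (hsig k) (hdu k) hq0 (mul_div_cancel₀ _ hK.ne').le ?_
    (init k) (oracle k) (horacle k)
  have hlog : 0 < Real.log (Q k).n :=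
    Real.log_pos (by exact_mod_cast (by omega : 1 < (Q k).n))
  have hlog' : 0 < √(Real.log (Q k).n) := Real.sqrt_pos.2 hlog
  have hlamk := hlam k
  have hm := (Q k).mAc_nonneg
  have hM := hc.trans_le (hcMA k)
  rw [Real.norm_of_nonneg (by positivity), Real.norm_of_nonneg (by positivity), mul_div_assoc',
    le_div_iff₀ hlog'] at hkg
  have h1 : c * ((Q k).mAc * (Q k).s * √(Real.log (Q k).n))
      ≤ (Q k).mAc * (Q k).MA * (Q k).s * √(Real.log (Q k).n) := by
    have := mul_le_mul_of_nonneg_right (hcMA k)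
      (by positivity : 0 ≤ (Q k).mAc * (Q k).s * √(Real.log (Q k).n))
    linarith
  refine le_of_mul_le_mul_left ?_ hc
  linarith
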